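/- Let $(\mathcal X,\rho_{\mathcal X})$ and $(\mathcal W,\rho_{\mathcal W})$ be probability spaces and let $\phi:\mathcal X\times\mathcal W\to\mathbb R$ be square-integrable with respect to $\rho_{\mathcal X}\otimes\rho_{\mathcal W}$. Let $x_1,x_2,\dots$ be i.i.d. with law $\rho_{\mathcal X}$ and $w_1,w_2,\dots$ i.i.d. with law $\rho_{\mathcal W}$, the two sequences being independent of each other, and put $\Phi_{i\alpha}=\phi(x_i,w_\alpha)$. Fix an integer $n\ge 1$. For positive integers $P,Q\ge n$ let $$\hat m_{P,Q}(n)=\frac{1}{\binom Pn\binom Qn}\sum_{1\le i_1<\dots<i_n\le P}\ \sum_{1\le\alpha_1<\dots<\alpha_n\le Q}\ \prod_{l=1}^n\Phi_{i_l\alpha_l}\Phi_{i_{l+1}\alpha_l},\qquad i_{n+1}=i_1,$$ and let $$m(n)=\int\prod_{l=1}^n d\rho_{\mathcal X}(x_l)\,d\rho_{\mathcal W}(w_l)\ \prod_{l=1}^n\phi(x_l,w_l)\,\phi(x_{l+1},w_l),\qquad x_{n+1}=x_1 .$$ Then the integral defining $m(n)$ converges absolutely, and $\hat m(n)$ is a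 strongly consistent estimator of $m(n)$ as $P,Q\to\infty$, in the following senses. 1. For all nondecreasing (deterministic) sequences of sample sizes $P_t\to\infty$, $Q_t\to\infty$, almost surely $\hat m_{P_t,Q_t}(n)\to m(n)$ as $t\to\infty$. 2. Almost surely, $\lim_{Q\to\infty}\hat m_{P,Q}(n)$ exists for every $P\ge n$, and $\lim_{P\to\infty}\lim_{Q\to\infty}\hat m_{P,Q}(n)=m(n)$; likewise, almost surely, $\lim_{P\to\infty}\hat m_{P,Q}(n)$ exists for every $Q\ge n$, and $\lim_{Q\to\infty}\lim_{P\to\infty}\hat m_{P,Q}(n)=m(n)$. 3. If moreover $\phi\in\mathcal L^4(\rho_{\mathcal X}\otimes\rho_{\mathcal W})$, then almost surely $\hat m_{P,Q}(n)\to m(n)$ as $P$ and $Q$ tend to infinity independently of each other (unrestricted double limit). -/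

import Mathlib

open MeasureTheory ProbabilityTheory Filter Topology

/-- The product `∏ₗ φ(xₗ, wₗ) φ(xₗ₊₁, wₗ)` over `l = 1, …, n` along a closed cycle, i.e. with the
convention `xₙ₊₁ = x₁` (`finRotate n` sends `l` to `l + 1` and the last index to the first). -/
def cyclicProduct {X W : Type*} {n : ℕ} (φ : X → W → ℝ) (x : Fin n → X) (w : Fin n → W) : ℝ :=
  ∏ l : Fin n, φ (x l) (w l) * φ (x (finRotate n l)) (w l)

/-- The moment `m(n) = ∫ ∏ₗ dρX(xₗ) dρW(wₗ) ∏ₗ φ(xₗ, wₗ) φ(xₗ₊₁, wₗ)`, with `xₙ₊₁ = x₁`. -/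
noncomputable def spectralMoment {X W : Type*} [MeasurableSpace X] [MeasurableSpace W]
    (φ : X → W → ℝ) (ρX : Measure X) (ρW : Measure W) (n : ℕ) : ℝ :=
  ∫ z : (Fin n → X) × (Fin n → W), cyclicProduct φ z.1 z.2
    ∂((Measure.pi fun _ : Fin n => ρX).prod (Measure.pi fun _ : Fin n => ρW))

open Classical in
/-- The estimator computed from a `P × Q` measurement matrix: the average of the cyclic products of
the matrix entries over all increasing row indices `i₁ < ⋯ < iₙ` and all increasing column
indices `α₁ < ⋯ < αₙ`. -/
noncomputable def momentEstimator (n : ℕ) {P Q : ℕ} (Φ : Matrix (Fin P) (Fin Q) ℝ) : ℝ :=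
  1 / ((P.choose n : ℝ) * (Q.choose n : ℝ)) *
    ∑ i : Fin n → Fin P with StrictMono i, ∑ α : Fin n → Fin Q with StrictMono α,
      cyclicProduct (fun a b => Φ a b) i α

/-- The `P × Q` measurement matrix `Φᵢₐ = φ(xᵢ, wₐ)` built from the first `P` terms of the sequence
`x` of inputs and the first `Q` terms of the sequence `w` of features. -/
def measurementMatrix {X W : Type*} (φ : X → W → ℝ) (x : ℕ → X) (w : ℕ → W) (P Q : ℕ) :
    Matrix (Fin P) (Fin Q) ℝ :=
  Matrix.of fun i α => φ (x i) (w α)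

/-! The cyclic product is the product of `φ` over the pairs (x_l, w_l) times the same product after
a cyclic shift of the x's. Each factor has L² norm ‖φ‖ⁿ, since its n pairs are independent.
Cauchy–Schwarz then gives integrability and shows that the cyclic product depends continuously, from
L² to L¹, on `φ` (`integral_abs_cyclicProduct_sub_le`). Hence m(n) is L²-continuous in `φ`. The same
inequality for the uniform measures on row and column indices makes the estimator continuous in the
normalised Frobenius norm, with a modulus independent of P and Q (`abs_momentEstimator_sub_le`).

Finite sums of products a(x) b(w) of bounded functions are dense in L². For them the estimator is a
finite sum of terms (average over the x's) · (average over the w's), each over increasing tuples and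
each convergent by the strong law (`tendsto_orderedSum_div_choose`). So for such functions even the
unrestricted double limit holds.

It remains to show that the grid average of f = (φ - ψ)², which is only integrable, is eventually at
most a constant times any positive bound for ∫ f. Truncate f at level PQ and split off its row and
column means (Hoeffding decomposition). The means obey the ordinary strong law; the doubly centred
rest has orthogonal entries, so Chebyshev applies. The probability of exceeding the truncation level
and the Chebyshev bound are both controlled by the expectation of `truncationCost`, and
Borel–Cantelli is run over dyadic sizes (2^a, 2^b). Monotone sample sizes visit only a chain of
pairs (a, b), on which a + b is injective, and ∑_k `truncationCost (2 ^ k) v` ≤ 4v: integrability of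
f suffices. Independent P and Q need all pairs (a, b); the bound v² / 2^(a+b) makes this summable
when f ∈ L², i.e. when φ ∈ L⁴. For iterated limits, the strong law in one variable, conditionally on
the other, replaces Borel–Cantelli. -/

/-! ### Continuity of the cyclic moments in L². -/

section PopulationBound

variable {X W : Type*} [MeasurableSpace X] [MeasurableSpace W]

/-- The product `∏ₗ φ(xₗ, wₗ)`, i.e. one half of the factors of `cyclicProduct`. -/
def edgeProduct {X W : Type*} {n : ℕ} (φ : X → W → ℝ) (x : Fin n → X) (w : Fin n → W) : ℝ :=
  ∏ l : Fin n, φ (x l) (w l)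

theorem cyclicProduct_eq_edgeProduct_mul {X W : Type*} {n : ℕ} (φ : X → W → ℝ)
    (x : Fin n → X) (w : Fin n → W) :
    cyclicProduct φ x w = edgeProduct φ x w * edgeProduct φ (x ∘ finRotate n) w := by
  simp [cyclicProduct, edgeProduct, Finset.prod_mul_distrib]

variable (ρX : Measure X) [IsProbabilityMeasure ρX] (ρW : Measure W) [IsProbabilityMeasure ρW]

theorem integrable_edgeProduct {φ : X → W → ℝ} (n : ℕ)
    (hφ : Integrable (fun z : X × W => φ z.1 z.2) (ρX.prod ρW)) :
    Integrable (fun z : (Fin n → X) × (Fin n → W) => edgeProduct φ z.1 z.2)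
      ((Measure.pi fun _ : Fin n => ρX).prod (Measure.pi fun _ : Fin n => ρW)) := by
  have h := (measurePreserving_arrowProdEquivProdArrow X W (Fin n) (fun _ => ρX) (fun _ => ρW))
  rw [← h.integrable_comp_emb (MeasurableEquiv.measurableEmbedding _)]
  exact Integrable.fintype_prod (fun _ => hφ)

/-- No index is shared between two factors, so after regrouping coordinates into pairs the integrand
is a product of n independent copies. -/
theorem integral_edgeProduct (φ : X → W → ℝ) (n : ℕ) :
    ∫ z : (Fin n → X) × (Fin n → W), edgeProduct φ z.1 z.2
      ∂((Measure.pi fun _ : Fin n => ρX).prod (Measure.pi fun _ : Fin n => ρW))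
      = (∫ z, φ z.1 z.2 ∂(ρX.prod ρW)) ^ n := by
  have h := (measurePreserving_arrowProdEquivProdArrow X W (Fin n) (fun _ => ρX) (fun _ => ρW))
  rw [← h.integral_comp (MeasurableEquiv.measurableEmbedding _)]
  have := integral_fintype_prod_eq_pow (ι := Fin n) (fun z : X × W => φ z.1 z.2) (μ := ρX.prod ρW)
  rw [Fintype.card_fin] at this
  exact this

theorem measurePreserving_rotate (n : ℕ) :
    MeasurePreserving (fun z : (Fin n → X) × (Fin n → W) => (z.1 ∘ finRotate n, z.2))
      ((Measure.pi fun _ : Fin n => ρX).prod (Measure.pi fun _ : Fin n => ρW))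
      ((Measure.pi fun _ : Fin n => ρX).prod (Measure.pi fun _ : Fin n => ρW)) := by
  have h1 : MeasurePreserving (fun x : Fin n → X => x ∘ finRotate n)
      (Measure.pi fun _ : Fin n => ρX) (Measure.pi fun _ : Fin n => ρX) := by
    have := measurePreserving_piCongrLeft (fun _ : Fin n => ρX) (finRotate n).symm
    convert this using 1
    ext x l
    simp [MeasurableEquiv.piCongrLeft, Equiv.piCongrLeft, Equiv.piCongrLeft']
  exact h1.prod (MeasurePreserving.id _)

theorem memLp_two_edgeProduct {φ : X → W → ℝ} (n : ℕ)
    (hφ : MemLp (fun z : X × W => φ z.1 z.2) 2 (ρX.prod ρW)) :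
    MemLp (fun z : (Fin n → X) × (Fin n → W) => edgeProduct φ z.1 z.2) 2
      ((Measure.pi fun _ : Fin n => ρX).prod (Measure.pi fun _ : Fin n => ρW)) := by
  have hm := (integrable_edgeProduct ρX ρW n (hφ.integrable one_le_two)).aestronglyMeasurable
  rw [memLp_two_iff_integrable_sq hm]
  have := integrable_edgeProduct ρX ρW (φ := fun x w => φ x w ^ 2) n hφ.integrable_sq
  simpa [edgeProduct, Finset.prod_pow] using this

theorem integral_edgeProduct_mul (φ ψ : X → W → ℝ) (n : ℕ) :
    ∫ z : (Fin n → X) × (Fin n → W), edgeProduct φ z.1 z.2 * edgeProduct ψ z.1 z.2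
      ∂((Measure.pi fun _ : Fin n => ρX).prod (Measure.pi fun _ : Fin n => ρW))
      = (∫ z, φ z.1 z.2 * ψ z.1 z.2 ∂(ρX.prod ρW)) ^ n := by
  rw [← integral_edgeProduct ρX ρW (fun x w => φ x w * ψ x w)]
  simp [edgeProduct, Finset.prod_mul_distrib]

theorem integral_abs_mul_le_sqrt {T : Type*} [MeasurableSpace T] {τ : Measure T} {f g : T → ℝ}
    (hf : MemLp f 2 τ) (hg : MemLp g 2 τ) :
    ∫ t, |f t| * |g t| ∂τ ≤ √(∫ t, f t ^ 2 ∂τ) * √(∫ t, g t ^ 2 ∂τ) := by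
  have := integral_mul_le_Lp_mul_Lq_of_nonneg (μ := τ) (p := 2) (q := 2)
    Real.HolderConjugate.two_two (f := fun t => |f t|) (g := fun t => |g t|)
    (ae_of_all _ fun t => abs_nonneg _) (ae_of_all _ fun t => abs_nonneg _)
    (by simpa using hf.norm) (by simpa using hg.norm)
  simpa [Real.sqrt_eq_rpow] using this

theorem integral_sub_sq_eq {T : Type*} [MeasurableSpace T] {τ : Measure T} {f g : T → ℝ}
    (hf : MemLp f 2 τ) (hg : MemLp g 2 τ) :
    ∫ t, (f t - g t) ^ 2 ∂τ = ∫ t, f t ^ 2 ∂τ - 2 * ∫ t, f t * g t ∂τ + ∫ t, g t ^ 2 ∂τ := by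
  have hfg : Integrable (fun t => 2 * (f t * g t)) τ := (hf.integrable_mul hg).const_mul 2
  have hs : Integrable (fun t => f t ^ 2 - 2 * (f t * g t)) τ := hf.integrable_sq.sub hfg
  rw [← integral_const_mul, ← integral_sub hf.integrable_sq hfg,
    ← integral_add hs hg.integrable_sq]
  exact integral_congr_ae (ae_of_all _ fun t => by simp only []; ring)

/-- A modulus of continuity for the cyclic moments of order `n`: here `B` bounds second moments
and `d` is the squared distance. -/
noncomputable def momentModulus (n : ℕ) (B d : ℝ) : ℝ :=
  √(2 * (n * B ^ (n - 1) * √(B * d))) * (2 * √(B ^ n))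

theorem momentModulus_nonneg (n : ℕ) (B d : ℝ) : 0 ≤ momentModulus n B d := by
  unfold momentModulus; positivity

theorem tendsto_momentModulus {ι : Type*} {l : Filter ι} (n : ℕ) (B : ℝ) {d : ι → ℝ}
    (hd : Tendsto d l (𝓝 0)) : Tendsto (fun k => momentModulus n B (d k)) l (𝓝 0) := by
  have hc : Continuous (momentModulus n B) := by unfold momentModulus; fun_prop
  have := (hc.tendsto 0).comp hd
  simpa [momentModulus, Function.comp_def] using this

/-- To be read with a = ‖φ‖², b = ⟨φ, ψ⟩, c = ‖ψ‖², d = ‖φ - ψ‖²; the left side is then the squared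
distance of the n-fold tensor powers. It splits as (aⁿ - bⁿ) + (cⁿ - bⁿ), and each difference is
bounded by the mean value inequality. -/
theorem sq_distance_pow_le {a b c d B : ℝ} (n : ℕ) (ha : 0 ≤ a) (hc : 0 ≤ c)
    (haB : a ≤ B) (hcB : c ≤ B) 
    (hab : |a - b| ≤ √(a * d)) (hbc : |c - b| ≤ √(c * d)) (hbB : |b| ≤ B) (hd0 : 0 ≤ d):
    a ^ n - 2 * b ^ n + c ^ n ≤ 2 * (n * B ^ (n - 1) * √(B * d)) := by
  have key : ∀ e, 0 ≤ e → e ≤ B → |e - b| ≤ √(e * d) → |e ^ n - b ^ n| ≤ n * B ^ (n - 1) * √(B * d) := by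
    intro e he heB h
    refine (abs_pow_sub_pow_le e b n).trans ?_
    have hmax : max |e| |b| ≤ B := max_le (by rwa [abs_of_nonneg he]) hbB
    have h3 : |e - b| ≤ √(B * d) := h.trans (Real.sqrt_le_sqrt (by gcongr))
    calc |e - b| * n * max |e| |b| ^ (n - 1) ≤ √(B * d) * n * B ^ (n - 1) := by
          gcongr
      _ = _ := by ring
  have e1 := (abs_le.1 (key a ha haB hab)).2
  have e2 := (abs_le.1 (key c hc hcB hbc)).2
  linarith

/-- With A, A' the edge products of `φ`, `ψ` and R, R' their rotations, AR - A'R' = (A - A')R + A'(R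
- R'). Cauchy–Schwarz applies to both terms, and rotation preserves the L² norms. -/
theorem integral_abs_cyclicProduct_sub_le {φ ψ : X → W → ℝ} (n : ℕ) {B d : ℝ}
    (hφ : MemLp (fun z : X × W => φ z.1 z.2) 2 (ρX.prod ρW))
    (hψ : MemLp (fun z : X × W => ψ z.1 z.2) 2 (ρX.prod ρW))
    (hφB : ∫ z, φ z.1 z.2 ^ 2 ∂(ρX.prod ρW) ≤ B) (hψB : ∫ z, ψ z.1 z.2 ^ 2 ∂(ρX.prod ρW) ≤ B)
    (hd : ∫ z, (φ z.1 z.2 - ψ z.1 z.2) ^ 2 ∂(ρX.prod ρW) ≤ d) :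
    ∫ z : (Fin n → X) × (Fin n → W), |cyclicProduct φ z.1 z.2 - cyclicProduct ψ z.1 z.2|
      ∂((Measure.pi fun _ : Fin n => ρX).prod (Measure.pi fun _ : Fin n => ρW))
      ≤ momentModulus n B d := by
  set τ := (Measure.pi fun _ : Fin n => ρX).prod (Measure.pi fun _ : Fin n => ρW) with hτ
  set π := ρX.prod ρW with hπ
  set a := ∫ z, φ z.1 z.2 ^ 2 ∂π with ha
  set c := ∫ z, ψ z.1 z.2 ^ 2 ∂π with hc
  set b := ∫ z, φ z.1 z.2 * ψ z.1 z.2 ∂π with hb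
  set e := ∫ z, (φ z.1 z.2 - ψ z.1 z.2) ^ 2 ∂π with he
  have ha0 : 0 ≤ a := integral_nonneg fun _ => sq_nonneg _
  have hc0 : 0 ≤ c := integral_nonneg fun _ => sq_nonneg _
  have he0 : 0 ≤ e := integral_nonneg fun _ => sq_nonneg _
  have hB : 0 ≤ B := ha0.trans hφB
  have iφ := hφ.integrable_sq
  have iψ := hψ.integrable_sq
  have iφψ : Integrable (fun z : X × W => φ z.1 z.2 * ψ z.1 z.2) π := hφ.integrable_mul hψ
  have heq : a - 2 * b + c = e := (integral_sub_sq_eq hφ hψ).symm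
  have hdiff : MemLp (fun z : X × W => φ z.1 z.2 - ψ z.1 z.2) 2 π := hφ.sub hψ
  have cs : ∀ f g : X × W → ℝ, MemLp f 2 π → MemLp g 2 π →
      |∫ z, f z * g z ∂π| ≤ √((∫ z, f z ^ 2 ∂π) * ∫ z, g z ^ 2 ∂π) := by
    intro f g hf hg
    rw [Real.sqrt_mul (integral_nonneg fun _ => sq_nonneg _)]
    refine le_trans (abs_integral_le_integral_abs) ?_
    simp_rw [abs_mul]
    exact integral_abs_mul_le_sqrt hf hg
  -- Here a - b = ⟨φ, φ - ψ⟩; the next bound uses c - b = -⟨ψ, φ - ψ⟩ in the same way.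
  have hab : |a - b| ≤ √(a * e) := by
    have := cs _ _ hφ hdiff
    convert this using 2
    rw [ha, hb, ← integral_sub iφ iφψ]
    exact integral_congr_ae (ae_of_all _ fun z => by simp only []; ring)
  have hbc : |c - b| ≤ √(c * e) := by
    have := cs _ _ hψ hdiff
    rw [abs_sub_comm]
    convert this using 2
    rw [hc, hb, ← integral_sub iφψ iψ]
    exact integral_congr_ae (ae_of_all _ fun z => by simp only []; ring)
  have hbB : |b| ≤ B := by
    refine (cs _ _ hφ hψ).trans ?_
    rw [Real.sqrt_le_left hB, sq]
    exact mul_le_mul hφB hψB hc0 hB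
  have hpow := (sq_distance_pow_le n ha0 hc0 hφB hψB hab hbc hbB he0).trans
    (show 2 * (n * B ^ (n - 1) * √(B * e)) ≤ 2 * (n * B ^ (n - 1) * √(B * d)) by gcongr)
  have hR := measurePreserving_rotate (X := X) (W := W) ρX ρW n
  have mA := memLp_two_edgeProduct ρX ρW n hφ
  have mA' := memLp_two_edgeProduct ρX ρW n hψ
  have mB := mA.comp_measurePreserving hR
  have mB' := mA'.comp_measurePreserving hR
  have hAA : ∫ z, edgeProduct φ z.1 z.2 ^ 2 ∂τ = a ^ n := by
    simp_rw [sq]; rw [integral_edgeProduct_mul]; simp_rw [← sq]; rfl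
  have hAA' : ∫ z, edgeProduct ψ z.1 z.2 ^ 2 ∂τ = c ^ n := by
    simp_rw [sq]; rw [integral_edgeProduct_mul]; simp_rw [← sq]; rfl
  have hD : ∫ z, (edgeProduct φ z.1 z.2 - edgeProduct ψ z.1 z.2) ^ 2 ∂τ
      = a ^ n - 2 * b ^ n + c ^ n := by
    rw [← hAA, ← hAA', hb, ← integral_edgeProduct_mul ρX ρW φ ψ n]
    exact integral_sub_sq_eq mA mA'
  have rot : ∀ F : (Fin n → X) × (Fin n → W) → ℝ, AEStronglyMeasurable F τ →
      ∫ z, F (z.1 ∘ finRotate n, z.2) ∂τ = ∫ z, F z ∂τ := by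
    intro F hF
    have := integral_map (μ := τ) hR.measurable.aemeasurable (f := F) (by rwa [hR.map_eq])
    rw [← this, hR.map_eq]
  have hBB : ∫ z, edgeProduct φ (z.1 ∘ finRotate n) z.2 ^ 2 ∂τ = a ^ n :=
    (rot (fun z => edgeProduct φ z.1 z.2 ^ 2) mA.integrable_sq.aestronglyMeasurable).trans hAA
  have hDB : ∫ z, (edgeProduct φ (z.1 ∘ finRotate n) z.2 - edgeProduct ψ (z.1 ∘ finRotate n) z.2) ^ 2 ∂τ
      = a ^ n - 2 * b ^ n + c ^ n :=
    (rot (fun z => (edgeProduct φ z.1 z.2 - edgeProduct ψ z.1 z.2) ^ 2)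
      (mA.sub mA').integrable_sq.aestronglyMeasurable).trans hD
  have s1 := integral_abs_mul_le_sqrt (mA.sub mA') mB
  have s2 := integral_abs_mul_le_sqrt mA' (mB.sub mB')
  have i1 : Integrable (fun z : (Fin n → X) × (Fin n → W) =>
      |edgeProduct φ z.1 z.2 - edgeProduct ψ z.1 z.2| * |edgeProduct φ (z.1 ∘ finRotate n) z.2|) τ :=
    MemLp.integrable_mul (mA.sub mA').norm mB.norm
  have i2 : Integrable (fun z : (Fin n → X) × (Fin n → W) => |edgeProduct ψ z.1 z.2| *
      |edgeProduct φ (z.1 ∘ finRotate n) z.2 - edgeProduct ψ (z.1 ∘ finRotate n) z.2|) τ :=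
    MemLp.integrable_mul mA'.norm (mB.sub mB').norm
  simp only [Pi.sub_apply, Function.comp_apply] at s1 s2
  rw [hD, hBB] at s1
  rw [hDB, hAA'] at s2
  calc _ ≤ ∫ z, (|edgeProduct φ z.1 z.2 - edgeProduct ψ z.1 z.2| *
          |edgeProduct φ (z.1 ∘ finRotate n) z.2| + |edgeProduct ψ z.1 z.2| *
      |edgeProduct φ (z.1 ∘ finRotate n) z.2 - edgeProduct ψ (z.1 ∘ finRotate n) z.2|) ∂τ := by
        refine integral_mono_of_nonneg (ae_of_all _ fun _ => abs_nonneg _) (i1.add i2)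
          (ae_of_all _ fun z => ?_)
        simp only [cyclicProduct_eq_edgeProduct_mul, ← abs_mul]
        refine le_trans (le_of_eq ?_) (abs_add_le _ _)
        congr 1; ring
    _ ≤ √(a ^ n - 2 * b ^ n + c ^ n) * √(a ^ n) + √(c ^ n) * √(a ^ n - 2 * b ^ n + c ^ n) := by
        rw [integral_add i1 i2]; exact add_le_add s1 s2
    _ ≤ √(2 * (n * B ^ (n - 1) * √(B * d))) * √(B ^ n) +
          √(B ^ n) * √(2 * (n * B ^ (n - 1) * √(B * d))) := by gcongr
    _ = momentModulus n B d := by unfold momentModulus; ring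

theorem integrable_cyclicProduct {φ : X → W → ℝ} (n : ℕ)
    (hφ : MemLp (fun z : X × W => φ z.1 z.2) 2 (ρX.prod ρW)) :
    Integrable (fun z : (Fin n → X) × (Fin n → W) => cyclicProduct φ z.1 z.2)
      ((Measure.pi fun _ : Fin n => ρX).prod (Measure.pi fun _ : Fin n => ρW)) := by
  have mA := memLp_two_edgeProduct ρX ρW n hφ
  have mB := mA.comp_measurePreserving (measurePreserving_rotate ρX ρW n)
  simp_rw [cyclicProduct_eq_edgeProduct_mul]
  exact mA.integrable_mul mB

theorem abs_spectralMoment_sub_le {φ ψ : X → W → ℝ} (n : ℕ) {B d : ℝ}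
    (hφ : MemLp (fun z : X × W => φ z.1 z.2) 2 (ρX.prod ρW))
    (hψ : MemLp (fun z : X × W => ψ z.1 z.2) 2 (ρX.prod ρW))
    (hφB : ∫ z, φ z.1 z.2 ^ 2 ∂(ρX.prod ρW) ≤ B) (hψB : ∫ z, ψ z.1 z.2 ^ 2 ∂(ρX.prod ρW) ≤ B)
    (hd : ∫ z, (φ z.1 z.2 - ψ z.1 z.2) ^ 2 ∂(ρX.prod ρW) ≤ d) :
    |spectralMoment φ ρX ρW n - spectralMoment ψ ρX ρW n| ≤ momentModulus n B d := by
  rw [spectralMoment, spectralMoment, ← integral_sub (integrable_cyclicProduct ρX ρW n hφ)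
    (integrable_cyclicProduct ρX ρW n hψ)]
  exact abs_integral_le_integral_abs.trans
    (integral_abs_cyclicProduct_sub_le ρX ρW n hφ hψ hφB hψB hd)

end PopulationBound

/-! ### The same continuity for the estimator, uniformly in the matrix size. -/

section EmpiricalBound

/-- The average of the entries of a matrix. -/
noncomputable def matrixAverage {P Q : ℕ} (Φ : Fin P → Fin Q → ℝ) : ℝ :=
  (∑ i, ∑ α, Φ i α) / (P * Q)

/-- The uniform probability measure on `Fin P`. -/
noncomputable def uniformFin (P : ℕ) : Measure (Fin P) := (P : ENNReal)⁻¹ • Measure.count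

theorem uniformFin_singleton {P : ℕ} (i : Fin P) : uniformFin P {i} = (P : ENNReal)⁻¹ := by
  simp [uniformFin]

theorem isProbabilityMeasure_uniformFin {P : ℕ} (hP : 0 < P) :
    IsProbabilityMeasure (uniformFin P) := by
  constructor
  simp [uniformFin, Measure.count_apply]
  exact ENNReal.inv_mul_cancel (by simp; omega) (by simp)

theorem integral_uniformFin_prod {P Q : ℕ} (hP : 0 < P) (hQ : 0 < Q) (Φ : Fin P → Fin Q → ℝ) :
    ∫ z, Φ z.1 z.2 ∂((uniformFin P).prod (uniformFin Q)) = matrixAverage Φ := by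
  have := isProbabilityMeasure_uniformFin hP
  have := isProbabilityMeasure_uniformFin hQ
  rw [integral_fintype .of_finite]
  have : ∀ z : Fin P × Fin Q, ((uniformFin P).prod (uniformFin Q)).real {z} = (P * Q : ℝ)⁻¹ := by
    rintro ⟨i, α⟩
    rw [Measure.real, ← Set.singleton_prod_singleton, Measure.prod_prod, uniformFin_singleton,
      uniformFin_singleton]
    simp [mul_comm]
  simp_rw [this, Fintype.sum_prod_type, matrixAverage, smul_eq_mul, ← Finset.mul_sum]
  rw [div_eq_inv_mul]

theorem integral_pi_uniformFin_prod {P Q : ℕ} (n : ℕ) (hP : 0 < P) (hQ : 0 < Q)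
    (F : (Fin n → Fin P) × (Fin n → Fin Q) → ℝ) :
    ∫ z, F z ∂((Measure.pi fun _ : Fin n => uniformFin P).prod
      (Measure.pi fun _ : Fin n => uniformFin Q)) = (∑ i, ∑ α, F (i, α)) / (P ^ n * Q ^ n) := by
  have := isProbabilityMeasure_uniformFin hP
  have := isProbabilityMeasure_uniformFin hQ
  rw [integral_fintype .of_finite]
  have : ∀ z : (Fin n → Fin P) × (Fin n → Fin Q), ((Measure.pi fun _ : Fin n => uniformFin P).prod
      (Measure.pi fun _ : Fin n => uniformFin Q)).real {z} = (P ^ n * Q ^ n : ℝ)⁻¹ := by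
    rintro ⟨i, α⟩
    rw [Measure.real, ← Set.singleton_prod_singleton, Measure.prod_prod, Measure.pi_singleton,
      Measure.pi_singleton]
    simp [uniformFin_singleton, mul_comm]
  simp_rw [this, Fintype.sum_prod_type, smul_eq_mul, ← Finset.mul_sum]
  rw [div_eq_inv_mul]

/-- Increasing tuples are a fixed positive proportion of all tuples: P ≤ n(P + 1 - n) for 1 ≤ n ≤ P,
and (P + 1 - n)ⁿ ≤ n! · C(P, n). -/
theorem pow_le_mul_choose {n P : ℕ} (hn : 1 ≤ n) (hP : n ≤ P) :
    (P : ℝ) ^ n ≤ (n ^ n * n.factorial) * P.choose n := by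
  have h1 : P ≤ n * (P + 1 - n) := by
    obtain ⟨m, rfl⟩ := Nat.exists_eq_add_of_le hP
    obtain ⟨k, rfl⟩ := Nat.exists_eq_add_of_le hn
    have : 1 + k + m + 1 - (1 + k) = m + 1 := by omega
    rw [this]; nlinarith
  have h2 := Nat.pow_le_choose (α := ℝ) n P
  rw [div_le_iff₀ (by positivity)] at h2
  calc (P : ℝ) ^ n ≤ (n * (P + 1 - n : ℕ) : ℝ) ^ n := by
        gcongr; exact_mod_cast h1
    _ = n ^ n * ((P + 1 - n : ℕ) ^ n : ℝ) := mul_pow _ _ _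
    _ ≤ n ^ n * (P.choose n * n.factorial) := by gcongr
    _ = _ := by ring

/-- The estimator is continuous with respect to the normalised Frobenius norm, uniformly in the size
of the matrix. -/
theorem abs_momentEstimator_sub_le {n P Q : ℕ} (hn : 1 ≤ n) (Φ Ψ : Matrix (Fin P) (Fin Q) ℝ)
    {B d : ℝ} (hΦ : matrixAverage (fun i α => Φ i α ^ 2) ≤ B)
    (hΨ : matrixAverage (fun i α => Ψ i α ^ 2) ≤ B)
    (hd : matrixAverage (fun i α => (Φ i α - Ψ i α) ^ 2) ≤ d) :
    |momentEstimator n Φ - momentEstimator n Ψ|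
      ≤ (n ^ n * n.factorial : ℝ) ^ 2 * momentModulus n B d := by
  classical
  set K : ℝ := n ^ n * n.factorial with hK
  have hR : 0 ≤ K ^ 2 * momentModulus n B d := mul_nonneg (sq_nonneg _) (momentModulus_nonneg _ _ _)
  -- For P < n or Q < n a binomial coefficient vanishes, and both estimators are 0 by the convention
  -- 1 / 0 = 0.
  rcases lt_or_ge P n with hP | hP
  · simpa [momentEstimator, Nat.choose_eq_zero_of_lt hP] using hR
  rcases lt_or_ge Q n with hQ | hQ
  · simpa [momentEstimator, Nat.choose_eq_zero_of_lt hQ] using hR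
  have hP0 : 0 < P := by omega
  have hQ0 : 0 < Q := by omega
  have := isProbabilityMeasure_uniformFin hP0
  have := isProbabilityMeasure_uniformFin hQ0
  have hlp : ∀ Φ : Matrix (Fin P) (Fin Q) ℝ,
      MemLp (fun z : Fin P × Fin Q => Φ z.1 z.2) 2 ((uniformFin P).prod (uniformFin Q)) :=
    fun Φ => .of_discrete
  have key := integral_abs_cyclicProduct_sub_le (uniformFin P) (uniformFin Q) (φ := Φ) (ψ := Ψ)
    n (B := B) (d := d) (hlp Φ) (hlp Ψ) (by rwa [integral_uniformFin_prod hP0 hQ0 (fun i α => Φ i α ^ 2)])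
    (by rwa [integral_uniformFin_prod hP0 hQ0 (fun i α => Ψ i α ^ 2)])
    (by rwa [integral_uniformFin_prod hP0 hQ0 (fun i α => (Φ i α - Ψ i α) ^ 2)])
  rw [integral_pi_uniformFin_prod n hP0 hQ0] at key
  have cP : (0 : ℝ) < P.choose n := by exact_mod_cast Nat.choose_pos hP
  have cQ : (0 : ℝ) < Q.choose n := by exact_mod_cast Nat.choose_pos hQ
  rw [div_le_iff₀ (by positivity)] at key
  have e1 : momentEstimator n Φ - momentEstimator n Ψ = 1 / ((P.choose n : ℝ) * Q.choose n) *
      ∑ i : Fin n → Fin P with StrictMono i, ∑ α : Fin n → Fin Q with StrictMono α,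
        (cyclicProduct (fun a b => Φ a b) i α - cyclicProduct (fun a b => Ψ a b) i α) := by
    simp_rw [momentEstimator, Finset.sum_sub_distrib]
    ring
  rw [e1, abs_mul, abs_of_nonneg (by positivity), one_div, inv_mul_le_iff₀ (by positivity)]
  calc _ ≤ ∑ i : Fin n → Fin P with StrictMono i, ∑ α : Fin n → Fin Q with StrictMono α,
        |cyclicProduct (fun a b => Φ a b) i α - cyclicProduct (fun a b => Ψ a b) i α| :=
        (Finset.abs_sum_le_sum_abs _ _).trans
          (Finset.sum_le_sum fun _ _ => Finset.abs_sum_le_sum_abs _ _)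
    -- Adding the non-increasing tuples turns the sum into an integral for the uniform measures, at
    -- the cost of the factor `K ^ 2`.
    _ ≤ ∑ i : Fin n → Fin P, ∑ α : Fin n → Fin Q,
        |cyclicProduct (fun a b => Φ a b) i α - cyclicProduct (fun a b => Ψ a b) i α| := by
        refine (Finset.sum_le_sum fun i _ => Finset.sum_le_univ_sum_of_nonneg
          fun α => abs_nonneg _).trans
          (Finset.sum_le_univ_sum_of_nonneg fun i => Finset.sum_nonneg fun α _ => abs_nonneg _)
    _ ≤ momentModulus n B d * (P ^ n * Q ^ n) := key
    _ ≤ momentModulus n B d * ((K * P.choose n) * (K * Q.choose n)) := by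
        have := momentModulus_nonneg n B d
        gcongr
        · exact pow_le_mul_choose hn hP
        · exact pow_le_mul_choose hn hQ
    _ = _ := by ring

end EmpiricalBound

/-! ### Averages over increasing tuples of indices. -/

section OrderedSums
open Asymptotics

theorem sum_range_choose_right_real (m P : ℕ) :
    ∑ p ∈ Finset.range P, (p.choose m : ℝ) = P.choose (m + 1) := by
  induction P with
  | zero => simp
  | succ P ih => rw [Finset.sum_range_succ, ih, Nat.choose_succ_succ]; push_cast; ring

theorem tendsto_choose_succ_atTop (m : ℕ) :
    Tendsto (fun P : ℕ => (P.choose (m + 1) : ℝ)) atTop atTop := by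
  have h : Tendsto (fun P : ℕ => ((P - m : ℕ) : ℝ)) atTop atTop :=
    tendsto_natCast_atTop_atTop.comp (tendsto_sub_atTop_nat m)
  refine tendsto_atTop_mono' _ ?_ h
  filter_upwards [eventually_ge_atTop (m + 1)] with P hP
  obtain ⟨k, rfl⟩ := Nat.exists_eq_add_of_le hP
  have e : m + 1 + k - m = k + 1 := by omega
  rw [e]
  norm_cast
  clear h hP e
  induction k with
  | zero => simp
  | succ k ih =>
    rw [← add_assoc, Nat.choose_succ_succ']
    have : 0 < (m + 1 + k).choose m := Nat.choose_pos (by omega)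
    omega

theorem isBigO_mul_choose (m : ℕ) :
    (fun P : ℕ => (P : ℝ) * P.choose m) =O[atTop] fun P : ℕ => (P.choose (m + 1) : ℝ) := by
  refine IsBigO.of_bound (2 * (m + 1)) ?_
  filter_upwards [eventually_ge_atTop (2 * m)] with P hP
  rw [Real.norm_of_nonneg (by positivity), Real.norm_of_nonneg (by positivity)]
  have h := Nat.choose_succ_right_eq P m
  have h' : (P.choose (m + 1) : ℝ) * (m + 1) = P.choose m * (P - m) := by
    have := congrArg (Nat.cast (R := ℝ)) h
    rw [Nat.cast_mul, Nat.cast_mul, Nat.cast_sub (by omega)] at this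
    exact_mod_cast this
  have hP' : (2 * m : ℝ) ≤ P := by exact_mod_cast hP
  have : (0 : ℝ) ≤ P.choose m := by positivity
  nlinarith

/-- Cesàro convergence to zero implies convergence to zero of the means with weights
`p.choose m`. -/
theorem isLittleO_sum_choose_mul (m : ℕ) {z : ℕ → ℝ}
    (hz : (fun P : ℕ => ∑ p ∈ Finset.range P, z p) =o[atTop] fun P : ℕ => (P : ℝ)) :
    (fun P : ℕ => ∑ p ∈ Finset.range P, (p.choose m : ℝ) * z p)
      =o[atTop] fun P : ℕ => (P.choose (m + 1) : ℝ) := by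
  cases m with
  | zero => simpa using hz
  | succ m =>
    set Z : ℕ → ℝ := fun P => ∑ p ∈ Finset.range P, z p with hZ
    -- Summation by parts: C(q + 1, m + 1) - C(q, m + 1) = C(q, m). Both resulting terms inherit the
    -- little-o from `Z`.
    have e : (fun P : ℕ => ∑ p ∈ Finset.range P, (p.choose (m + 1) : ℝ) * z p) =
        fun P : ℕ => (P.choose (m + 1) : ℝ) * Z P
          - ∑ q ∈ Finset.range P, (q.choose m : ℝ) * Z (q + 1) := by
      funext P
      induction P with
      | zero => simp [hZ]
      | succ P ih =>
        rw [Finset.sum_range_succ, Finset.sum_range_succ, ih, Nat.choose_succ_succ]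
        have : Z (P + 1) = Z P + z P := Finset.sum_range_succ _ _
        rw [this]; push_cast; ring
    rw [e]
    refine IsLittleO.sub ?_ ?_
    · refine IsLittleO.trans_isBigO ?_ (isBigO_mul_choose (m + 1))
      simpa only [mul_comm] using (isBigO_refl (fun P : ℕ => (P.choose (m + 1) : ℝ)) atTop).mul_isLittleO hz
    · have h1 : (fun q : ℕ => (q.choose m : ℝ) * Z (q + 1)) =o[atTop]
          fun q : ℕ => ((q + 1).choose (m + 1) : ℝ) := by
        have h2 : (fun q : ℕ => Z (q + 1)) =o[atTop] fun q : ℕ => ((q + 1 : ℕ) : ℝ) :=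
          hz.comp_tendsto (tendsto_add_atTop_nat 1)
        refine ((isBigO_refl (fun q : ℕ => (q.choose m : ℝ)) atTop).mul_isLittleO h2).trans_isBigO ?_
        refine IsBigO.of_bound (m + 1) (Eventually.of_forall fun q => ?_)
        rw [Real.norm_of_nonneg (by positivity), Real.norm_of_nonneg (by positivity)]
        have := Nat.add_one_mul_choose_eq q m
        have : ((q + 1 : ℕ) : ℝ) * q.choose m = (q + 1).choose (m + 1) * (m + 1) := by
          exact_mod_cast this
        linarith
      have hsum : ∀ P : ℕ, ∑ q ∈ Finset.range P, ((q + 1).choose (m + 1) : ℝ)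
          = (P + 1).choose (m + 2) := by
        intro P
        have := sum_range_choose_right_real (m + 1) (P + 1)
        rw [Finset.sum_range_succ'] at this
        simpa using this
      have h3 := h1.sum_range (fun q => by positivity) (by
        simp_rw [hsum]
        exact (tendsto_choose_succ_atTop (m + 1)).comp (tendsto_add_atTop_nat 1))
      simp_rw [hsum] at h3
      refine h3.trans_isBigO ?_
      have h4 : (fun P : ℕ => (P.choose (m + 1) : ℝ)) =O[atTop]
          fun P : ℕ => (P : ℝ) * P.choose (m + 1) := by
        refine IsBigO.of_bound 1 ?_
        filter_upwards [eventually_ge_atTop 1] with P hP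
        rw [Real.norm_of_nonneg (by positivity), Real.norm_of_nonneg (by positivity), one_mul]
        exact le_mul_of_one_le_left (by positivity) (by exact_mod_cast hP)
      refine ((h4.trans (isBigO_mul_choose (m + 1))).add (isBigO_refl _ _)).congr_left fun P => ?_
      rw [Nat.choose_succ_succ' P (m + 1)]
      push_cast
      rfl

open Classical in
/-- The sum of `∏ₗ y l (iₗ)` over all increasing tuples of indices below `P`. -/
noncomputable def orderedSum (n : ℕ) (y : Fin n → ℕ → ℝ) (P : ℕ) : ℝ :=
  ∑ i : Fin n → Fin P with StrictMono i, ∏ l, y l (i l)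

theorem orderedSum_zero (y : Fin 0 → ℕ → ℝ) (P : ℕ) : orderedSum 0 y P = 1 := by
  classical
  simp [orderedSum, Finset.filter_true_of_mem, Subsingleton.strictMono]

theorem orderedSum_eq_sum_piFinset (n : ℕ) (y : Fin n → ℕ → ℝ) (P : ℕ) :
    orderedSum n y P = ∑ i ∈ (Fintype.piFinset fun _ : Fin n => Finset.range P) with StrictMono i,
      ∏ l, y l (i l) := by
  classical
  refine Finset.sum_bij (fun i _ l => (i l : ℕ)) ?_ ?_ ?_ ?_
  · intro i hi
    simp only [Finset.mem_filter, Fintype.mem_piFinset, Finset.mem_range, Fin.is_lt, implies_true,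
      true_and, Finset.mem_univ] at hi ⊢
    exact hi
  · intro i _ j _ h
    funext l
    exact Fin.ext (congrFun h l)
  · intro j hj
    simp only [Finset.mem_filter, Fintype.mem_piFinset, Finset.mem_range] at hj
    refine ⟨fun l => ⟨j l, hj.1 l⟩, ?_, rfl⟩
    rw [Finset.mem_filter]
    exact ⟨Finset.mem_univ _, fun a b hab => hj.2 hab⟩
  · intros; rfl

/-- Sort the tuples by their largest index p; the remaining indices form an increasing tuple below
p. -/
theorem orderedSum_succ (n : ℕ) (y : Fin (n + 1) → ℕ → ℝ) (P : ℕ) :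
    orderedSum (n + 1) y P =
      ∑ p ∈ Finset.range P, y (Fin.last n) p * orderedSum n (fun l => y l.castSucc) p := by
  simp_rw [orderedSum_eq_sum_piFinset, Finset.mul_sum]
  rw [Finset.sum_sigma']
  refine Finset.sum_bij' (fun i _ => ⟨i (Fin.last n), fun l => i l.castSucc⟩)
    (fun s _ => Fin.snoc (α := fun _ => ℕ) s.2 s.1) ?_ ?_ ?_ ?_ ?_
  · intro i hi
    simp only [Finset.mem_filter, Fintype.mem_piFinset, Finset.mem_range, Finset.mem_sigma] at hi ⊢
    exact ⟨hi.1 _, fun l => hi.2 (Fin.castSucc_lt_last l),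
      fun a b hab => hi.2 (Fin.castSucc_lt_castSucc_iff.2 hab)⟩
  · rintro ⟨p, i⟩ hi
    simp only [Finset.mem_filter, Fintype.mem_piFinset, Finset.mem_range, Finset.mem_sigma] at hi ⊢
    obtain ⟨hp, hip, hmono⟩ := hi
    refine ⟨Fin.lastCases (by simpa using hp) fun l => by simpa using (hip l).trans hp, ?_⟩
    intro a b
    refine Fin.lastCases ?_ (fun b => ?_) b
    · refine Fin.lastCases (fun h => absurd h (lt_irrefl _)) (fun a _ => ?_) a
      simpa using hip a
    · refine Fin.lastCases (fun h => absurd h (Fin.castSucc_lt_last b).not_gt) (fun a h => ?_) a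
      simpa using hmono (Fin.castSucc_lt_castSucc_iff.1 h)
  · intro i _
    exact Fin.snoc_init_self i
  · rintro ⟨p, i⟩ _
    simp
  · intro i _
    rw [Fin.prod_univ_castSucc, mul_comm]

/-- If bounded sequences have Cesàro means, then the averages of products over increasing tuples
converge to the product of these means. -/
theorem tendsto_orderedSum_div_choose (n : ℕ) (y : Fin n → ℕ → ℝ) (c : Fin n → ℝ) (C : ℝ)
    (hb : ∀ l p, |y l p| ≤ C)
    (hy : ∀ l, Tendsto (fun P : ℕ => (∑ p ∈ Finset.range P, y l p) / P) atTop (𝓝 (c l))) :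
    Tendsto (fun P : ℕ => orderedSum n y P / P.choose n) atTop (𝓝 (∏ l, c l)) := by
  suffices h : (fun P : ℕ => orderedSum n y P - (∏ l, c l) * P.choose n) =o[atTop]
      fun P : ℕ => (P.choose n : ℝ) by
    have h1 := h.tendsto_div_nhds_zero
    have h2 := h1.add_const (∏ l, c l)
    rw [zero_add] at h2
    refine h2.congr' ?_
    filter_upwards [eventually_ge_atTop n] with P hP
    have : (P.choose n : ℝ) ≠ 0 := by exact_mod_cast (Nat.choose_pos hP).ne'
    field_simp
    ring
  induction n with
  | zero => simp [orderedSum_zero]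
  | succ n ih =>
    have ih' := ih (fun l => y l.castSucc) (fun l => c l.castSucc) (fun l p => hb _ p)
      (fun l => hy _)
    set κ := ∏ l : Fin n, c l.castSucc
    have hz : (fun P : ℕ => ∑ p ∈ Finset.range P, (y (Fin.last n) p - c (Fin.last n))) =o[atTop]
        fun P : ℕ => (P : ℝ) := by
      rw [isLittleO_iff_tendsto' (by
        filter_upwards [eventually_gt_atTop 0] with P hP h
        exact absurd h (by positivity))]
      have := (hy (Fin.last n)).sub_const (c (Fin.last n))
      rw [sub_self] at this
      refine this.congr' ?_
      filter_upwards [eventually_gt_atTop 0] with P hP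
      have : (P : ℝ) ≠ 0 := by positivity
      rw [Finset.sum_sub_distrib]
      simp
      field_simp
    -- With S_p the ordered sum of the first n sequences, the error is ∑ y_p (S_p - κ C(p, n)) + κ ∑
    -- C(p, n) (y_p - c). The second sum is a weighted Cesàro mean; the first is small by induction,
    -- as `y` is bounded.
    have h1 := (isLittleO_sum_choose_mul n hz).const_mul_left κ
    have h2 : (fun p : ℕ => y (Fin.last n) p *
        (orderedSum n (fun l => y l.castSucc) p - κ * p.choose n)) =o[atTop]
        fun p : ℕ => (p.choose n : ℝ) := by
      have hB : (fun p : ℕ => y (Fin.last n) p) =O[atTop] fun _ => (1 : ℝ) :=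
        IsBigO.of_bound C (Eventually.of_forall fun p => by simpa using hb _ p)
      simpa using hB.mul_isLittleO ih'
    have h3 := h2.sum_range (fun q => by positivity) (by
      simp_rw [sum_range_choose_right_real]; exact tendsto_choose_succ_atTop n)
    simp_rw [sum_range_choose_right_real] at h3
    refine (h3.add h1).congr_left fun P => ?_
    rw [orderedSum_succ, Fin.prod_univ_castSucc, ← sum_range_choose_right_real, Finset.mul_sum,
      Finset.mul_sum, ← Finset.sum_add_distrib, ← Finset.sum_sub_distrib]
    refine Finset.sum_congr rfl fun p _ => ?_
    ring

end OrderedSums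

/-! ### Density of finite sums of products a(x) b(w). -/

section SeparableSums

variable {X W : Type*} [MeasurableSpace X] [MeasurableSpace W]

/-- A finite sum of products `a(x) b(w)` of bounded measurable functions. -/
def IsSeparableSum (ψ : X → W → ℝ) : Prop :=
  ∃ (ι : Type) (_ : Fintype ι) (a : ι → X → ℝ) (b : ι → W → ℝ) (C : ℝ),
    (∀ r, Measurable (a r)) ∧ (∀ r, Measurable (b r)) ∧ (∀ r x, |a r x| ≤ C) ∧
    (∀ r w, |b r w| ≤ C) ∧ ψ = fun x w => ∑ r, a r x * b r w

theorem isSeparableSum_mul {a : X → ℝ} {b : W → ℝ} {C : ℝ} (ha : Measurable a) (hb : Measurable b)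
    (haC : ∀ x, |a x| ≤ C) (hbC : ∀ w, |b w| ≤ C) : IsSeparableSum fun x w => a x * b w :=
  ⟨Unit, inferInstance, fun _ => a, fun _ => b, C, fun _ => ha, fun _ => hb, fun _ => haC,
    fun _ => hbC, by simp⟩

theorem isSeparableSum_const (c : ℝ) : IsSeparableSum fun (_ : X) (_ : W) => c := by
  have := isSeparableSum_mul (X := X) (W := W) (a := fun _ => c) (b := fun _ => 1) (C := |c| + 1)
    measurable_const measurable_const (fun _ => by linarith) (fun _ => by simp)
  simpa using this

theorem IsSeparableSum.add {f g : X → W → ℝ} (hf : IsSeparableSum f) (hg : IsSeparableSum g) :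
    IsSeparableSum fun x w => f x w + g x w := by
  obtain ⟨ι, _, a, b, C, ha, hb, haC, hbC, rfl⟩ := hf
  obtain ⟨κ, _, a', b', C', ha', hb', haC', hbC', rfl⟩ := hg
  refine ⟨ι ⊕ κ, inferInstance, Sum.elim a a', Sum.elim b b', max C C', ?_, ?_, ?_, ?_, ?_⟩
  · rintro (r | r) <;> simp [ha, ha']
  · rintro (r | r) <;> simp [hb, hb']
  · rintro (r | r) x
    · exact (haC r x).trans (le_max_left _ _)
    · exact (haC' r x).trans (le_max_right _ _)
  · rintro (r | r) x
    · exact (hbC r x).trans (le_max_left _ _)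
    · exact (hbC' r x).trans (le_max_right _ _)
  · simp

theorem IsSeparableSum.mul {f g : X → W → ℝ} (hf : IsSeparableSum f) (hg : IsSeparableSum g) :
    IsSeparableSum fun x w => f x w * g x w := by
  obtain ⟨ι, _, a, b, C, ha, hb, haC, hbC, rfl⟩ := hf
  obtain ⟨κ, _, a', b', C', ha', hb', haC', hbC', rfl⟩ := hg
  refine ⟨ι × κ, inferInstance, fun r x => a r.1 x * a' r.2 x, fun r w => b r.1 w * b' r.2 w,
    C * C', fun r => (ha _).mul (ha' _), fun r => (hb _).mul (hb' _), ?_, ?_, ?_⟩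
  · rintro r x
    rw [abs_mul]
    exact mul_le_mul (haC _ _) (haC' _ _) (abs_nonneg _) ((abs_nonneg _).trans (haC r.1 x))
  · rintro r x
    rw [abs_mul]
    exact mul_le_mul (hbC _ _) (hbC' _ _) (abs_nonneg _) ((abs_nonneg _).trans (hbC r.1 x))
  · funext x w
    rw [Finset.sum_mul_sum, Fintype.sum_prod_type]
    refine Finset.sum_congr rfl fun r _ => Finset.sum_congr rfl fun s _ => ?_
    ring

theorem IsSeparableSum.const_mul {f : X → W → ℝ} (c : ℝ) (hf : IsSeparableSum f) :
    IsSeparableSum fun x w => c * f x w :=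
  (isSeparableSum_const c).mul hf

theorem IsSeparableSum.sub {f g : X → W → ℝ} (hf : IsSeparableSum f) (hg : IsSeparableSum g) :
    IsSeparableSum fun x w => f x w - g x w := by
  simpa [sub_eq_add_neg] using hf.add (hg.const_mul (-1))

theorem IsSeparableSum.measurable {f : X → W → ℝ} (hf : IsSeparableSum f) :
    Measurable fun z : X × W => f z.1 z.2 := by
  obtain ⟨ι, _, a, b, C, ha, hb, -, -, rfl⟩ := hf
  exact Finset.measurable_sum _ fun r _ =>
    ((ha r).comp measurable_fst).mul ((hb r).comp measurable_snd)

theorem IsSeparableSum.exists_bound {f : X → W → ℝ} (hf : IsSeparableSum f) :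
    ∃ C, ∀ x w, |f x w| ≤ C := by
  obtain ⟨ι, _, a, b, C, -, -, ha, hb, rfl⟩ := hf
  refine ⟨∑ _ : ι, C * C, fun x w => (Finset.abs_sum_le_sum_abs _ _).trans ?_⟩
  refine Finset.sum_le_sum fun r _ => ?_
  rw [abs_mul]
  exact mul_le_mul (ha r x) (hb r w) (abs_nonneg _) ((abs_nonneg _).trans (ha r x))

variable (ρX : Measure X) [IsProbabilityMeasure ρX] (ρW : Measure W) [IsProbabilityMeasure ρW]

theorem IsSeparableSum.memLp {f : X → W → ℝ} (hf : IsSeparableSum f) (p : ENNReal) :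
    MemLp (fun z : X × W => f z.1 z.2) p (ρX.prod ρW) := by
  obtain ⟨C, hC⟩ := hf.exists_bound
  exact MemLp.of_bound hf.measurable.aestronglyMeasurable C (ae_of_all _ fun z => hC _ _)

/-- Separable sums form an algebra, and the indicators of s ∪ t and s \ t are polynomials in those
of s and t. -/
theorem isSetRing_setOf_isSeparableSum_indicator :
    IsSetRing {s : Set (X × W) | IsSeparableSum fun x w => s.indicator (fun _ => (1 : ℝ)) (x, w)} where
  empty_mem := by simpa using isSeparableSum_const 0
  union_mem {s t} hs ht := by
    have := (hs.add ht).sub (hs.mul ht)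
    simp only [Set.mem_ofPred_eq]
    convert this using 3 with x w
    by_cases h1 : (x, w) ∈ s <;> by_cases h2 : (x, w) ∈ t <;> simp [h1, h2]
  sdiff_mem {s t} hs ht := by
    have := hs.sub (hs.mul ht)
    simp only [Set.mem_ofPred_eq]
    convert this using 3 with x w
    by_cases h1 : (x, w) ∈ s <;> by_cases h2 : (x, w) ∈ t <;> simp [h1, h2]

theorem isSeparableSum_indicator_prod {s : Set X} {t : Set W} (hs : MeasurableSet s)
    (ht : MeasurableSet t) :
    IsSeparableSum fun x w => (s ×ˢ t).indicator (fun _ => (1 : ℝ)) (x, w) := by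
  have := isSeparableSum_mul (C := 1) (measurable_const.indicator hs : Measurable (s.indicator fun _ => (1 : ℝ)))
    (measurable_const.indicator ht : Measurable (t.indicator fun _ => (1 : ℝ))) 
    (fun x => by by_cases h : x ∈ s <;> simp [h]) (fun x => by by_cases h : x ∈ t <;> simp [h])
  convert this using 3 with x w
  by_cases h1 : x ∈ s <;> by_cases h2 : w ∈ t <;> simp [h1, h2]

theorem generateFrom_setOf_isSeparableSum_indicator :
    (Prod.instMeasurableSpace : MeasurableSpace (X × W)) = MeasurableSpace.generateFrom
      {s : Set (X × W) | IsSeparableSum fun x w => s.indicator (fun _ => (1 : ℝ)) (x, w)} := by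
  apply le_antisymm
  · rw [← generateFrom_prod]
    refine MeasurableSpace.generateFrom_mono ?_
    rintro _ ⟨s, hs, t, ht, rfl⟩
    exact isSeparableSum_indicator_prod hs ht
  · refine MeasurableSpace.generateFrom_le fun s hs => ?_
    have h := hs.measurable (measurableSet_singleton (1 : ℝ))
    convert h using 1
    ext z
    by_cases hz : z ∈ s <;> simp [hz]

/-- The ring of sets with separable indicator contains the rectangles, so it generates the product
σ-algebra and approximates `s` in measure. -/
theorem exists_isSeparableSum_eLpNorm_indicator_le {s : Set (X × W)} (hs : MeasurableSet s) (c : ℝ)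
    {ε : ENNReal} (hε : ε ≠ 0) : ∃ g : X × W → ℝ,
      eLpNorm (g - s.indicator fun _ => c) 2 (ρX.prod ρW) ≤ ε ∧
      IsSeparableSum fun x w => g (x, w) := by
  obtain ⟨δ, hδ, h⟩ := exists_eLpNorm_indicator_le (p := 2) (by simp) c hε (μ := ρX.prod ρW)
  obtain ⟨t, ht, hts⟩ := exists_measure_symmDiff_lt_of_generateFrom_isSetRing (μ := ρX.prod ρW)
    isSetRing_setOf_isSeparableSum_indicator
    ⟨{Set.univ}, Set.countable_singleton _, by
      simpa using isSeparableSum_const 1, by simp⟩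
    generateFrom_setOf_isSeparableSum_indicator hs (ε := δ) (by exact_mod_cast hδ)
  refine ⟨t.indicator fun _ => c, ?_, ?_⟩
  · have : eLpNorm (t.indicator (fun _ => c) - s.indicator fun _ => c) 2 (ρX.prod ρW)
        = eLpNorm ((symmDiff t s).indicator fun _ => c) 2 (ρX.prod ρW) := by
      refine eLpNorm_congr_norm_ae (ae_of_all _ fun z => ?_)
      by_cases h1 : z ∈ s <;> by_cases h2 : z ∈ t <;> simp [h1, h2, Set.mem_symmDiff]
    rw [this]
    exact h _ hts.le
  · have := IsSeparableSum.const_mul c ht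
    convert this using 3 with x w
    by_cases h1 : (x, w) ∈ t <;> simp [h1]

/-- Separable sums are dense in `L²` of a product of probability spaces. -/
theorem exists_isSeparableSum_integral_sq_sub_le {φ : X → W → ℝ}
    (hφ : MemLp (fun z : X × W => φ z.1 z.2) 2 (ρX.prod ρW)) {ε : ℝ} (hε : 0 < ε) :
    ∃ ψ : X → W → ℝ, IsSeparableSum ψ ∧
      ∫ z, (φ z.1 z.2 - ψ z.1 z.2) ^ 2 ∂(ρX.prod ρW) ≤ ε := by
  obtain ⟨g, hg, hgs⟩ := hφ.induction_dense (by simp)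
    (fun g : X × W → ℝ => IsSeparableSum fun x w => g (x, w))
    (fun c s hs _ ε hε => exists_isSeparableSum_eLpNorm_indicator_le ρX ρW hs c hε)
    (fun f g hf hg => hf.add hg) (fun f hf => hf.measurable.aestronglyMeasurable)
    (ε := ENNReal.ofReal √ε) (by simpa using hε)
  refine ⟨fun x w => g (x, w), hgs, ?_⟩
  have hd := hφ.sub (hgs.memLp ρX ρW 2)
  have h2 := hd.eLpNorm_eq_integral_rpow_norm (by simp) (by simp)
  have h3 : eLpNorm ((fun z : X × W => φ z.1 z.2) - fun z : X × W => g (z.1, z.2)) 2 (ρX.prod ρW)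
      ≤ ENNReal.ofReal √ε := hg
  rw [h2, ENNReal.ofReal_le_ofReal_iff (Real.sqrt_nonneg _)] at h3
  simp only [ENNReal.toReal_ofNat, Real.rpow_ofNat, Pi.sub_apply, Real.norm_eq_abs, sq_abs] at h3
  rw [Real.sqrt_eq_rpow, show (2 : ℝ)⁻¹ = 1 / 2 by norm_num] at h3
  exact (Real.rpow_le_rpow_iff (integral_nonneg fun _ => sq_nonneg _) hε.le (by norm_num)).1 h3

end SeparableSums

/-! ### Estimator and moment of a separable sum. -/

section SeparableMoments

variable {X W : Type*} [MeasurableSpace X] [MeasurableSpace W]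

/-- Here r_l is the term chosen in φ(x_l, w_l) and s_l the one chosen in φ(x_{l+1}, w_l). So x_l
meets r_l and s_{l-1}, which is the origin of the inverse rotation, while w_l meets r_l and s_l. -/
theorem cyclicProduct_sum {ι : Type*} [Fintype ι] {X W : Type*} {n : ℕ} (a : ι → X → ℝ) (b : ι → W → ℝ)
    (x : Fin n → X) (w : Fin n → W) :
    cyclicProduct (fun x w => ∑ r, a r x * b r w) x w =
      ∑ r : (Fin n → ι), ∑ s : (Fin n → ι),
        (∏ l, a (r l) (x l) * a (s ((finRotate n).symm l)) (x l)) *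
          ∏ l, b (r l) (w l) * b (s l) (w l) := by
  classical
  rw [cyclicProduct, Finset.prod_mul_distrib, Fintype.prod_sum, Fintype.prod_sum,
    Finset.sum_mul_sum]
  refine Finset.sum_congr rfl fun r _ => Finset.sum_congr rfl fun s _ => ?_
  have h : ∏ l, a (s l) (x (finRotate n l)) = ∏ l, a (s ((finRotate n).symm l)) (x l) :=
    Fintype.prod_equiv (finRotate n) _ _ fun l => by rw [Equiv.symm_apply_apply]
  simp_rw [Finset.prod_mul_distrib, h]
  ring

theorem sum_sum_comm_sum_sum {α β γ δ : Type*} (A : Finset α) (B : Finset β) (C : Finset γ)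
    (D : Finset δ) (F : α → β → γ → δ → ℝ) :
    ∑ a ∈ A, ∑ b ∈ B, ∑ c ∈ C, ∑ d ∈ D, F a b c d =
      ∑ c ∈ C, ∑ d ∈ D, ∑ a ∈ A, ∑ b ∈ B, F a b c d := by
  have e1 : ∀ a b, ∑ c ∈ C, ∑ d ∈ D, F a b c d = ∑ p ∈ C ×ˢ D, F a b p.1 p.2 :=
    fun a b => (Finset.sum_product' _ _ _).symm
  have e2 : ∀ c d, ∑ a ∈ A, ∑ b ∈ B, F a b c d = ∑ p ∈ A ×ˢ B, F p.1 p.2 c d :=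
    fun c d => (Finset.sum_product' _ _ fun a b => F a b c d).symm
  simp_rw [e1, e2]
  rw [← Finset.sum_product' A B fun a b => ∑ p ∈ C ×ˢ D, F a b p.1 p.2,
    ← Finset.sum_product' C D fun c d => ∑ p ∈ A ×ˢ B, F p.1 p.2 c d, Finset.sum_comm]

/-- Each term separates into a factor depending on P and the x's and one depending on Q and the w's;
this is why the rates of P and Q play no role here. -/
theorem momentEstimator_sum {ι : Type*} [Fintype ι] {X W : Type*} {n : ℕ} (a : ι → X → ℝ)
    (b : ι → W → ℝ) (x : ℕ → X) (w : ℕ → W) (P Q : ℕ) :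
    momentEstimator n (measurementMatrix (fun x w => ∑ r, a r x * b r w) x w P Q) =
      ∑ r : (Fin n → ι), ∑ s : (Fin n → ι),
        (orderedSum n (fun l p => a (r l) (x p) * a (s ((finRotate n).symm l)) (x p)) P
          / P.choose n) *
        (orderedSum n (fun l q => b (r l) (w q) * b (s l) (w q)) Q / Q.choose n) := by
  classical
  have h : ∀ (i : Fin n → Fin P) (α : Fin n → Fin Q),
      cyclicProduct (fun p q => measurementMatrix (fun x w => ∑ r, a r x * b r w) x w P Q p q) i α =
        ∑ r : (Fin n → ι), ∑ s : (Fin n → ι),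
        (∏ l, a (r l) (x (i l)) * a (s ((finRotate n).symm l)) (x (i l))) *
          ∏ l, b (r l) (w (α l)) * b (s l) (w (α l)) :=
    fun i α => cyclicProduct_sum (fun r (p : Fin P) => a r (x p)) (fun r (q : Fin Q) => b r (w q)) i α
  simp_rw [momentEstimator, h, orderedSum]
  rw [sum_sum_comm_sum_sum]
  simp_rw [Finset.mul_sum]
  refine Finset.sum_congr rfl fun r _ => Finset.sum_congr rfl fun s _ => ?_
  simp_rw [div_mul_div_comm, Finset.sum_mul_sum, Finset.sum_div]
  refine Finset.sum_congr rfl fun i _ => Finset.sum_congr rfl fun α _ => ?_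
  ring

variable (ρX : Measure X) [IsProbabilityMeasure ρX] (ρW : Measure W) [IsProbabilityMeasure ρW]

theorem integrable_mul_of_abs_le {Y : Type*} [MeasurableSpace Y] (ρ : Measure Y) [IsFiniteMeasure ρ]
    {f g : Y → ℝ} {C : ℝ} (hf : Measurable f) (hg : Measurable g) (hfC : ∀ y, |f y| ≤ C)
    (hgC : ∀ y, |g y| ≤ C) : Integrable (fun y => f y * g y) ρ := by
  refine Integrable.of_bound (hf.mul hg).aestronglyMeasurable (C * C) (ae_of_all _ fun y => ?_)
  rw [Real.norm_eq_abs, abs_mul]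
  exact mul_le_mul (hfC y) (hgC y) (abs_nonneg _) ((abs_nonneg _).trans (hfC y))

theorem spectralMoment_sum {ι : Type*} [Fintype ι] {n : ℕ} {a : ι → X → ℝ}
    {b : ι → W → ℝ} {C : ℝ} (ha : ∀ r, Measurable (a r)) (hb : ∀ r, Measurable (b r))
    (haC : ∀ r x, |a r x| ≤ C) (hbC : ∀ r w, |b r w| ≤ C) :
    spectralMoment (fun x w => ∑ r, a r x * b r w) ρX ρW n =
      ∑ r : (Fin n → ι), ∑ s : (Fin n → ι),
        (∏ l, ∫ x, a (r l) x * a (s ((finRotate n).symm l)) x ∂ρX) *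
          ∏ l, ∫ w, b (r l) w * b (s l) w ∂ρW := by
  simp_rw [spectralMoment, cyclicProduct_sum]
  have hA : ∀ r s : Fin n → ι, Integrable (fun x : Fin n → X =>
      ∏ l, a (r l) (x l) * a (s ((finRotate n).symm l)) (x l)) (Measure.pi fun _ => ρX) :=
    fun r s => Integrable.fintype_prod
      fun l => integrable_mul_of_abs_le ρX (ha _) (ha _) (haC _) (haC _)
  have hB : ∀ r s : Fin n → ι, Integrable (fun w : Fin n → W =>
      ∏ l, b (r l) (w l) * b (s l) (w l)) (Measure.pi fun _ => ρW) :=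
    fun r s => Integrable.fintype_prod
      fun l => integrable_mul_of_abs_le ρW (hb _) (hb _) (hbC _) (hbC _)
  have hAB := fun r s => (hA r s).mul_prod (hB r s)
  rw [integral_finsetSum _ fun r _ => integrable_finsetSum _ fun s _ => hAB r s]
  refine Finset.sum_congr rfl fun r _ => ?_
  rw [integral_finsetSum _ fun s _ => hAB r s]
  refine Finset.sum_congr rfl fun s _ => ?_
  rw [integral_prod_mul (fun x : Fin n → X =>
      ∏ l, a (r l) (x l) * a (s ((finRotate n).symm l)) (x l)) (fun w : Fin n → W =>
      ∏ l, b (r l) (w l) * b (s l) (w l)),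
    integral_fintype_prod_eq_prod (fun l x => a (r l) x * a (s ((finRotate n).symm l)) x),
    integral_fintype_prod_eq_prod (fun l w => b (r l) w * b (s l) w)]

theorem tendsto_momentEstimator_sum {ι : Type*} [Fintype ι] {n : ℕ} {a : ι → X → ℝ}
    {b : ι → W → ℝ} {C : ℝ} (ha : ∀ r, Measurable (a r)) (hb : ∀ r, Measurable (b r))
    (haC : ∀ r x, |a r x| ≤ C) (hbC : ∀ r w, |b r w| ≤ C) {x : ℕ → X} {w : ℕ → W}
    (hx : ∀ r s, Tendsto (fun P : ℕ => (∑ p ∈ Finset.range P, a r (x p) * a s (x p)) / P) atTop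
      (𝓝 (∫ x, a r x * a s x ∂ρX)))
    (hw : ∀ r s, Tendsto (fun Q : ℕ => (∑ q ∈ Finset.range Q, b r (w q) * b s (w q)) / Q) atTop
      (𝓝 (∫ w, b r w * b s w ∂ρW))) :
    Tendsto (fun p : ℕ × ℕ => momentEstimator n
        (measurementMatrix (fun x w => ∑ r, a r x * b r w) x w p.1 p.2)) (atTop ×ˢ atTop)
      (𝓝 (spectralMoment (fun x w => ∑ r, a r x * b r w) ρX ρW n)) := by
  simp_rw [momentEstimator_sum, spectralMoment_sum ρX ρW ha hb haC hbC]
  refine tendsto_finsetSum _ fun r _ => tendsto_finsetSum _ fun s _ => Tendsto.mul ?_ ?_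
  · refine Tendsto.comp (tendsto_orderedSum_div_choose n _ _ (C * C) (fun l p => ?_)
      fun l => hx _ _) tendsto_fst
    rw [abs_mul]
    exact mul_le_mul (haC _ _) (haC _ _) (abs_nonneg _) ((abs_nonneg _).trans (haC (r l) (x p)))
  · refine Tendsto.comp (tendsto_orderedSum_div_choose n _ _ (C * C) (fun l p => ?_)
      fun l => hw _ _) tendsto_snd
    rw [abs_mul]
    exact mul_le_mul (hbC _ _) (hbC _ _) (abs_nonneg _) ((abs_nonneg _).trans (hbC (r l) (w p)))

end SeparableMoments

/-! ### The strong law for the two samples. -/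

section Sampling

variable {X W Ω : Type*} [MeasurableSpace X] [MeasurableSpace W] [MeasurableSpace Ω]

/-- Two independent sequences of samples, each independent and identically distributed, with laws
`ρX` and `ρW`. -/
structure IsIIDSampling (ρX : Measure X) (ρW : Measure W) (μ : Measure Ω) (x : ℕ → Ω → X)
    (w : ℕ → Ω → W) : Prop where
  measurable_input : ∀ i, Measurable (x i)
  measurable_feature : ∀ α, Measurable (w α)
  law_input : ∀ i, μ.map (x i) = ρX
  law_feature : ∀ α, μ.map (w α) = ρW
  iIndepFun_input : iIndepFun x μ
  iIndepFun_feature : iIndepFun w μ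
  indepFun : IndepFun (fun ω i => x i ω) (fun ω α => w α ω) μ

variable {ρX : Measure X} {ρW : Measure W} {μ : Measure Ω}
  {x : ℕ → Ω → X} {w : ℕ → Ω → W}

theorem IsIIDSampling.swap (h : IsIIDSampling ρX ρW μ x w) : IsIIDSampling ρW ρX μ w x :=
  ⟨h.measurable_feature, h.measurable_input, h.law_feature, h.law_input, h.iIndepFun_feature, h.iIndepFun_input,
    h.indepFun.symm⟩

theorem IsIIDSampling.ae_tendsto_average (h : IsIIDSampling ρX ρW μ x w) {f : X → ℝ}
    (hf : Measurable f) (hfi : Integrable f ρX) :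
    ∀ᵐ ω ∂μ, Tendsto (fun P : ℕ => (∑ p ∈ Finset.range P, f (x p ω)) / P) atTop
      (𝓝 (∫ y, f y ∂ρX)) := by
  have hint : Integrable (fun ω => f (x 0 ω)) μ := by
    rw [← h.law_input 0] at hfi
    exact hfi.comp_measurable (h.measurable_input 0)
  have := strong_law_ae_real (μ := μ) (fun p ω => f (x p ω)) hint
    (fun i j hij => (h.iIndepFun_input.indepFun hij).comp hf hf)
    (fun i => (IdentDistrib.mk (h.measurable_input i).aemeasurable (h.measurable_input 0).aemeasurable
      (by rw [h.law_input, h.law_input])).comp hf)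
  have e : ∫ y, f y ∂ρX = ∫ ω, f (x 0 ω) ∂μ := by
    rw [← h.law_input 0, integral_map (h.measurable_input 0).aemeasurable hf.aestronglyMeasurable]
  rwa [e]

theorem IsIIDSampling.ae_tendsto_average_mul [IsFiniteMeasure ρX] (h : IsIIDSampling ρX ρW μ x w)
    {ι : Type*} [Countable ι] {a : ι → X → ℝ} {C : ℝ} (ha : ∀ r, Measurable (a r))
    (haC : ∀ r x, |a r x| ≤ C) :
    ∀ᵐ ω ∂μ, ∀ r s, Tendsto (fun P : ℕ =>
      (∑ p ∈ Finset.range P, a r (x p ω) * a s (x p ω)) / P) atTop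
      (𝓝 (∫ x, a r x * a s x ∂ρX)) := by
  simp_rw [ae_all_iff]
  exact fun r s => h.ae_tendsto_average ((ha r).mul (ha s))
    (integrable_mul_of_abs_le ρX (ha _) (ha _) (haC _) (haC _))

theorem IsIIDSampling.ae_tendsto_momentEstimator_of_isSeparableSum [IsProbabilityMeasure ρX]
    [IsProbabilityMeasure ρW] (h : IsIIDSampling ρX ρW μ x w) (n : ℕ) {ψ : X → W → ℝ}
    (hψ : IsSeparableSum ψ) :
    ∀ᵐ ω ∂μ, Tendsto (fun p : ℕ × ℕ => momentEstimator n
        (measurementMatrix ψ (x · ω) (w · ω) p.1 p.2)) (atTop ×ˢ atTop)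
      (𝓝 (spectralMoment ψ ρX ρW n)) := by
  obtain ⟨ι, _, a, b, C, ha, hb, haC, hbC, rfl⟩ := hψ
  filter_upwards [h.ae_tendsto_average_mul ha haC, h.swap.ae_tendsto_average_mul hb hbC] with ω e1 e2
  exact tendsto_momentEstimator_sum ρX ρW ha hb haC hbC e1 e2

end Sampling

/-! ### Orthogonality of doubly centred kernels on the grid. -/

section SecondMoments

theorem IndepFun.prodMk_of_prodMk {Ω U V Z : Type*} [MeasurableSpace Ω] [MeasurableSpace U]
    [MeasurableSpace V] [MeasurableSpace Z] {μ : Measure Ω} [IsProbabilityMeasure μ]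
    {u : Ω → U} {v : Ω → V} {z : Ω → Z} (hu : Measurable u) (hv : Measurable v)
    (hz : Measurable z) (huv : IndepFun u v μ) (huvz : IndepFun (fun ω => (u ω, v ω)) z μ) :
    IndepFun u (fun ω => (v ω, z ω)) μ := by
  have := Measure.isProbabilityMeasure_map (μ := μ) hu.aemeasurable
  have := Measure.isProbabilityMeasure_map (μ := μ) hv.aemeasurable
  have := Measure.isProbabilityMeasure_map (μ := μ) hz.aemeasurable
  have hvz : IndepFun v z μ := huvz.comp measurable_snd measurable_id
  rw [indepFun_iff_map_prod_eq_prod_map_map hu.aemeasurable (hv.prodMk hz).aemeasurable]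
  rw [indepFun_iff_map_prod_eq_prod_map_map hu.aemeasurable hv.aemeasurable] at huv
  rw [indepFun_iff_map_prod_eq_prod_map_map (hu.prodMk hv).aemeasurable hz.aemeasurable, huv] at huvz
  rw [indepFun_iff_map_prod_eq_prod_map_map hv.aemeasurable hz.aemeasurable] at hvz
  rw [hvz, ← (measurePreserving_prodAssoc (μ.map u) (μ.map v) (μ.map z)).map_eq, ← huvz,
    Measure.map_map (MeasurableEquiv.measurable _) ((hu.prodMk hv).prodMk hz)]
  rfl

variable {X W Ω : Type*} [MeasurableSpace X] [MeasurableSpace W] [MeasurableSpace Ω]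
  {ρX : Measure X} {ρW : Measure W} {μ : Measure Ω} 
  [IsProbabilityMeasure μ]
  {x : ℕ → Ω → X} {w : ℕ → Ω → W}

theorem IsIIDSampling.isProbabilityMeasure_input (h : IsIIDSampling ρX ρW μ x w) :
    IsProbabilityMeasure ρX :=
  h.law_input 0 ▸ Measure.isProbabilityMeasure_map (h.measurable_input 0).aemeasurable

theorem IsIIDSampling.map_prodMk (h : IsIIDSampling ρX ρW μ x w) (i α : ℕ) :
    μ.map (fun ω => (x i ω, w α ω)) = ρX.prod ρW := by
  have hi : IndepFun (x i) (w α) μ :=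
    h.indepFun.comp (φ := fun y : ℕ → X => y i) (ψ := fun y : ℕ → W => y α)
      (measurable_pi_apply i) (measurable_pi_apply α)
  rw [indepFun_iff_map_prod_eq_prod_map_map (h.measurable_input i).aemeasurable
    (h.measurable_feature α).aemeasurable] at hi
  rw [hi, h.law_input, h.law_feature]

theorem IsIIDSampling.measurePreserving (h : IsIIDSampling ρX ρW μ x w) (i α : ℕ) :
    MeasurePreserving (fun ω => (x i ω, w α ω)) μ (ρX.prod ρW) :=
  ⟨(h.measurable_input i).prodMk (h.measurable_feature α), h.map_prodMk i α⟩

/-- Since i ≠ j, x_i is independent of (x_j, w_α, w_β) jointly, and integrating over x_i first kills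
the first factor. The case α = β is included. -/
theorem IsIIDSampling.integral_mul_eq_zero (h : IsIIDSampling ρX ρW μ x w) {g : X → W → ℝ} {C : ℝ}
    (hg : Measurable fun z : X × W => g z.1 z.2) (hC : ∀ y v, |g y v| ≤ C)
    (hg0 : ∀ v, ∫ y, g y v ∂ρX = 0) {i j : ℕ} (hij : i ≠ j) (α β : ℕ) :
    ∫ ω, g (x i ω) (w α ω) * g (x j ω) (w β ω) ∂μ = 0 := by
  have := h.isProbabilityMeasure_input
  have mx := h.measurable_input
  have mw := h.measurable_feature
  have hind : IndepFun (x i) (fun ω => (x j ω, (w α ω, w β ω))) μ := by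
    refine IndepFun.prodMk_of_prodMk (mx i) (mx j) ((mw α).prodMk (mw β))
      (h.iIndepFun_input.indepFun hij) ?_
    exact h.indepFun.comp (φ := fun y : ℕ → X => (y i, y j)) (ψ := fun y : ℕ → W => (y α, y β))
      ((measurable_pi_apply i).prodMk (measurable_pi_apply j))
      ((measurable_pi_apply α).prodMk (measurable_pi_apply β))
  have mV : Measurable fun ω => (x j ω, (w α ω, w β ω)) := (mx j).prodMk ((mw α).prodMk (mw β))
  rw [indepFun_iff_map_prod_eq_prod_map_map (mx i).aemeasurable mV.aemeasurable, h.law_input] at hind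
  have := Measure.isProbabilityMeasure_map (μ := μ) mV.aemeasurable
  set ν := μ.map fun ω => (x j ω, (w α ω, w β ω))
  let F : X × (X × (W × W)) → ℝ := fun z => g z.1 z.2.2.1 * g z.2.1 z.2.2.2
  have mF : Measurable F :=
    (hg.comp (measurable_fst.prodMk measurable_snd.snd.fst)).mul
      (hg.comp (measurable_snd.fst.prodMk measurable_snd.snd.snd))
  have iF : Integrable F (ρX.prod ν) := by
    refine Integrable.of_bound mF.aestronglyMeasurable (C * C) (ae_of_all _ fun z => ?_)
    rw [Real.norm_eq_abs, abs_mul]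
    exact mul_le_mul (hC _ _) (hC _ _) (abs_nonneg _) ((abs_nonneg _).trans (hC z.1 z.2.2.1))
  calc ∫ ω, g (x i ω) (w α ω) * g (x j ω) (w β ω) ∂μ
      = ∫ z, F z ∂(ρX.prod ν) := by
        rw [← hind, integral_map ((mx i).prodMk mV).aemeasurable mF.aestronglyMeasurable]
    _ = ∫ v, ∫ y, F (y, v) ∂ρX ∂ν := integral_prod_symm _ iF
    _ = 0 := by simp [F, integral_mul_const, hg0]

/-- The average of `f` over the grid of the first `P` terms of `x` and the first `Q` terms of
`w`. -/
noncomputable def gridAverage {X W : Type*} (f : X → W → ℝ) (x : ℕ → X) (w : ℕ → W) (P Q : ℕ) : ℝ :=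
  (∑ p ∈ Finset.range P, ∑ q ∈ Finset.range Q, f (x p) (w q)) / (P * Q)

/-- Distinct grid points differ in their row or their column, and centring in that variable makes
their entries orthogonal; only the PQ diagonal terms survive. -/
theorem IsIIDSampling.integral_gridAverage_sq (h : IsIIDSampling ρX ρW μ x w) {g : X → W → ℝ}
    {C : ℝ} (hg : Measurable fun z : X × W => g z.1 z.2) (hC : ∀ y v, |g y v| ≤ C)
    (hgX : ∀ v, ∫ y, g y v ∂ρX = 0) (hgW : ∀ y, ∫ v, g y v ∂ρW = 0) (P Q : ℕ) :
    ∫ ω, gridAverage g (x · ω) (w · ω) P Q ^ 2 ∂μ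
      = (∫ z, g z.1 z.2 ^ 2 ∂(ρX.prod ρW)) / (P * Q) := by
  have e : ∀ ω, gridAverage g (x · ω) (w · ω) P Q ^ 2
      = (∑ a ∈ Finset.range P ×ˢ Finset.range Q, ∑ b ∈ Finset.range P ×ˢ Finset.range Q,
        g (x a.1 ω) (w a.2 ω) * g (x b.1 ω) (w b.2 ω)) / (P * Q) ^ 2 := by
    intro ω
    rw [gridAverage, ← Finset.sum_product' _ _ fun p q => g (x p ω) (w q ω), div_pow, sq (∑ _ ∈ _, _),
      Finset.sum_mul_sum]
  have hm : ∀ a : ℕ × ℕ, Measurable fun ω => g (x a.1 ω) (w a.2 ω) := fun a =>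
    hg.comp ((h.measurable_input a.1).prodMk (h.measurable_feature a.2))
  have hi : ∀ a b : ℕ × ℕ, Integrable (fun ω => g (x a.1 ω) (w a.2 ω) * g (x b.1 ω) (w b.2 ω)) μ :=
    fun a b => integrable_mul_of_abs_le μ (hm a) (hm b) (fun _ => hC _ _) fun _ => hC _ _
  have hab : ∀ a b : ℕ × ℕ, ∫ ω, g (x a.1 ω) (w a.2 ω) * g (x b.1 ω) (w b.2 ω) ∂μ
      = if a = b then ∫ z, g z.1 z.2 ^ 2 ∂(ρX.prod ρW) else 0 := by
    rintro ⟨i, α⟩ ⟨j, β⟩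
    split_ifs with hij
    · cases hij
      rw [← h.map_prodMk i α, integral_map (h.measurePreserving i α).measurable.aemeasurable
        (hg.pow_const 2).aestronglyMeasurable]
      simp only [sq]
    · by_cases hij' : i = j
      · have hαβ : α ≠ β := fun e => hij (by rw [hij', e])
        exact h.swap.integral_mul_eq_zero (g := fun v y => g y v) (hg.comp measurable_swap)
          (fun _ _ => hC _ _) hgW hαβ i j
      · exact h.integral_mul_eq_zero hg hC hgX hij' α β
  simp_rw [e, integral_div]
  rw [integral_finsetSum _ fun a _ => integrable_finsetSum _ fun b _ => hi a b]
  simp_rw [integral_finsetSum _ fun b _ => hi _ b, hab]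
  rw [Finset.sum_congr rfl fun a ha => Finset.sum_ite_eq_of_mem _ a _ ha]
  simp only [Finset.sum_const, Finset.card_product, Finset.card_range, nsmul_eq_mul, Nat.cast_mul]
  rcases eq_or_ne ((P : ℝ) * Q) 0 with h0 | h0
  · simp [h0]
  · field_simp

end SecondMoments

/-! ### Hoeffding decomposition of a bounded kernel. -/

section Centering

variable {X W : Type*} [MeasurableSpace X] [MeasurableSpace W]
  (ρX : Measure X) (ρW : Measure W)

/-- The doubly centred function `u - ∫ u dρW - ∫ u dρX + ∫ u d(ρX ⊗ ρW)`. -/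
noncomputable def doublyCentered (u : X → W → ℝ) (y : X) (v : W) : ℝ :=
  u y v - ∫ v', u y v' ∂ρW - ∫ y', u y' v ∂ρX + ∫ z, u z.1 z.2 ∂(ρX.prod ρW)

theorem gridAverage_eq_doublyCentered (u : X → W → ℝ) (x : ℕ → X) (w : ℕ → W) {P Q : ℕ}
    (hP : 0 < P) (hQ : 0 < Q) :
    gridAverage u x w P Q = gridAverage (doublyCentered ρX ρW u) x w P Q
      + (∑ p ∈ Finset.range P, ∫ v, u (x p) v ∂ρW) / P
      + (∑ q ∈ Finset.range Q, ∫ y, u y (w q) ∂ρX) / Q - ∫ z, u z.1 z.2 ∂(ρX.prod ρW) := by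
  simp only [gridAverage, doublyCentered, Finset.sum_add_distrib, Finset.sum_sub_distrib,
    Finset.sum_const, Finset.card_range, nsmul_eq_mul, ← Finset.mul_sum]
  have : (P : ℝ) ≠ 0 := by positivity
  have : (Q : ℝ) ≠ 0 := by positivity
  field_simp
  ring

variable [IsProbabilityMeasure ρX] [IsProbabilityMeasure ρW]

theorem abs_integral_le_of_abs_le {Y : Type*} [MeasurableSpace Y] (ρ : Measure Y)
    [IsProbabilityMeasure ρ] {f : Y → ℝ} {C : ℝ} (hf : ∀ y, |f y| ≤ C) : |∫ y, f y ∂ρ| ≤ C := by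
  have := norm_integral_le_of_norm_le_const (μ := ρ) (f := f) (C := C) (ae_of_all _ hf)
  simpa using this

theorem sq_integral_le_integral_sq {Y : Type*} [MeasurableSpace Y] (ρ : Measure Y)
    [IsProbabilityMeasure ρ] {f : Y → ℝ} (hf : MemLp f 2 ρ) :
    (∫ y, f y ∂ρ) ^ 2 ≤ ∫ y, f y ^ 2 ∂ρ := by
  have h1 := variance_nonneg f ρ
  rw [variance_eq_sub hf] at h1
  simpa using h1

variable {u : X → W → ℝ} {C : ℝ}

theorem measurable_integral_left (hu : Measurable fun z : X × W => u z.1 z.2) :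
    Measurable fun y => ∫ v, u y v ∂ρW :=
  (StronglyMeasurable.integral_prod_right (f := u) hu.stronglyMeasurable).measurable

theorem measurable_integral_right (hu : Measurable fun z : X × W => u z.1 z.2) :
    Measurable fun v => ∫ y, u y v ∂ρX :=
  (StronglyMeasurable.integral_prod_left (f := u) hu.stronglyMeasurable).measurable

theorem measurable_doublyCentered (hu : Measurable fun z : X × W => u z.1 z.2) :
    Measurable fun z : X × W => doublyCentered ρX ρW u z.1 z.2 :=
  ((hu.sub ((measurable_integral_left ρW hu).comp measurable_fst)).sub
    ((measurable_integral_right ρX hu).comp measurable_snd)).add_const _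

theorem abs_doublyCentered_le (hC : ∀ y v, |u y v| ≤ C) (y : X) (v : W) :
    |doublyCentered ρX ρW u y v| ≤ 4 * C := by
  have h1 := abs_le.1 (hC y v)
  have h2 := abs_le.1 (abs_integral_le_of_abs_le ρW (hC y))
  have h3 := abs_le.1 (abs_integral_le_of_abs_le ρX fun y => hC y v)
  have h4 := abs_le.1 (abs_integral_le_of_abs_le (ρX.prod ρW) fun z => hC z.1 z.2)
  rw [doublyCentered, abs_le]
  constructor <;> linarith

theorem integrable_of_abs_le {Y : Type*} [MeasurableSpace Y] (ρ : Measure Y) [IsFiniteMeasure ρ]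
    {f : Y → ℝ} {C : ℝ} (hf : Measurable f) (hfC : ∀ y, |f y| ≤ C) : Integrable f ρ :=
  Integrable.of_bound hf.aestronglyMeasurable C (ae_of_all _ hfC)

theorem integral_doublyCentered_right (hu : Measurable fun z : X × W => u z.1 z.2)
    (hC : ∀ y v, |u y v| ≤ C) (y : X) : ∫ v, doublyCentered ρX ρW u y v ∂ρW = 0 := by
  have i1 : Integrable (fun v => u y v) ρW :=
    integrable_of_abs_le ρW (hu.comp measurable_prodMk_left) (hC y)
  have i2 : Integrable (fun v => ∫ y', u y' v ∂ρX) ρW :=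
    integrable_of_abs_le ρW (measurable_integral_right ρX hu)
      fun v => abs_integral_le_of_abs_le ρX fun y => hC y v
  have i0 : Integrable (fun z : X × W => u z.1 z.2) (ρX.prod ρW) :=
    integrable_of_abs_le _ hu fun z => hC _ _
  have j1 : Integrable (fun v => u y v - ∫ v', u y v' ∂ρW) ρW := i1.sub (integrable_const _)
  have j2 : Integrable (fun v => u y v - ∫ v', u y v' ∂ρW - ∫ y', u y' v ∂ρX) ρW := j1.sub i2
  simp only [doublyCentered]
  rw [integral_add j2 (integrable_const _), integral_sub j1 i2, integral_sub i1 (integrable_const _),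
    integral_prod_symm _ i0]
  simp

theorem integral_doublyCentered_left (hu : Measurable fun z : X × W => u z.1 z.2)
    (hC : ∀ y v, |u y v| ≤ C) (v : W) : ∫ y, doublyCentered ρX ρW u y v ∂ρX = 0 := by
  have i1 : Integrable (fun y => u y v) ρX :=
    integrable_of_abs_le ρX (hu.comp measurable_prodMk_right) fun y => hC y v
  have i2 : Integrable (fun y => ∫ v', u y v' ∂ρW) ρX :=
    integrable_of_abs_le ρX (measurable_integral_left ρW hu)
      fun y => abs_integral_le_of_abs_le ρW (hC y)
  have i0 : Integrable (fun z : X × W => u z.1 z.2) (ρX.prod ρW) :=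
    integrable_of_abs_le _ hu fun z => hC _ _
  have j1 : Integrable (fun y => u y v - ∫ v', u y v' ∂ρW) ρX := i1.sub i2
  have j2 : Integrable (fun y => u y v - ∫ v', u y v' ∂ρW - ∫ y', u y' v ∂ρX) ρX :=
    j1.sub (integrable_const _)
  simp only [doublyCentered]
  rw [integral_add j2 (integrable_const _), integral_sub j1 (integrable_const _), integral_sub i1 i2, integral_prod _ i0]
  simp

/-- The constant is 4 · 4: the square of a sum of four terms is at most four times the sum of
squares, and by Jensen each term has second moment at most that of `u`. -/
theorem integral_doublyCentered_sq_le (hu : Measurable fun z : X × W => u z.1 z.2)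
    (hC : ∀ y v, |u y v| ≤ C) :
    ∫ z, doublyCentered ρX ρW u z.1 z.2 ^ 2 ∂(ρX.prod ρW)
      ≤ 16 * ∫ z, u z.1 z.2 ^ 2 ∂(ρX.prod ρW) := by
  have m1 := measurable_integral_left ρW hu
  have m2 := measurable_integral_right ρX hu
  have b1 : ∀ y, |∫ v, u y v ∂ρW| ≤ C := fun y => abs_integral_le_of_abs_le ρW (hC y)
  have b2 : ∀ v, |∫ y, u y v ∂ρX| ≤ C := fun v => abs_integral_le_of_abs_le ρX fun y => hC y v
  have i0 : Integrable (fun z : X × W => u z.1 z.2 ^ 2) (ρX.prod ρW) :=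
    (MemLp.of_bound hu.aestronglyMeasurable C (ae_of_all _ fun z => hC _ _)).integrable_sq
  have i1 : Integrable (fun z : X × W => (∫ v, u z.1 v ∂ρW) ^ 2) (ρX.prod ρW) :=
    (MemLp.of_bound (m1.comp measurable_fst).aestronglyMeasurable C
      (ae_of_all _ fun z => b1 _)).integrable_sq
  have i2 : Integrable (fun z : X × W => (∫ y, u y z.2 ∂ρX) ^ 2) (ρX.prod ρW) :=
    (MemLp.of_bound (m2.comp measurable_snd).aestronglyMeasurable C
      (ae_of_all _ fun z => b2 _)).integrable_sq
  set c := ∫ z, u z.1 z.2 ∂(ρX.prod ρW) with hc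
  set A := ∫ z, u z.1 z.2 ^ 2 ∂(ρX.prod ρW) with hA
  have h1 : ∫ z, (∫ v, u z.1 v ∂ρW) ^ 2 ∂(ρX.prod ρW) ≤ A := by
    rw [hA, integral_prod _ i0, integral_fun_fst (fun y => (∫ v, u y v ∂ρW) ^ 2)]
    simp only [probReal_univ, one_smul]
    refine integral_mono_of_nonneg (ae_of_all _ fun _ => sq_nonneg _) i0.integral_prod_left
      (ae_of_all _ fun y => ?_)
    exact sq_integral_le_integral_sq ρW (MemLp.of_bound
      (hu.comp measurable_prodMk_left).aestronglyMeasurable C (ae_of_all _ (hC y)))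
  have h2 : ∫ z, (∫ y, u y z.2 ∂ρX) ^ 2 ∂(ρX.prod ρW) ≤ A := by
    rw [hA, integral_prod_symm _ i0, integral_fun_snd (fun v => (∫ y, u y v ∂ρX) ^ 2)]
    simp only [probReal_univ, one_smul]
    refine integral_mono_of_nonneg (ae_of_all _ fun _ => sq_nonneg _) i0.integral_prod_right
      (ae_of_all _ fun v => ?_)
    exact sq_integral_le_integral_sq ρX (MemLp.of_bound
      (hu.comp measurable_prodMk_right).aestronglyMeasurable C (ae_of_all _ fun y => hC y v))
  have h3 : c ^ 2 ≤ A := sq_integral_le_integral_sq (ρX.prod ρW)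
    (MemLp.of_bound hu.aestronglyMeasurable C (ae_of_all _ fun z => hC _ _))
  have j1 : Integrable (fun z : X × W => u z.1 z.2 ^ 2 + (∫ v, u z.1 v ∂ρW) ^ 2)
    (ρX.prod ρW) := i0.add i1
  have j2 : Integrable (fun z : X × W => u z.1 z.2 ^ 2 + (∫ v, u z.1 v ∂ρW) ^ 2
      + (∫ y, u y z.2 ∂ρX) ^ 2) (ρX.prod ρW) := j1.add i2
  have hsum : Integrable (fun z : X × W => u z.1 z.2 ^ 2 + (∫ v, u z.1 v ∂ρW) ^ 2
      + (∫ y, u y z.2 ∂ρX) ^ 2 + c ^ 2) (ρX.prod ρW) := j2.add (integrable_const _)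
  calc ∫ z, doublyCentered ρX ρW u z.1 z.2 ^ 2 ∂(ρX.prod ρW)
      ≤ ∫ z : X × W, 4 * (u z.1 z.2 ^ 2 + (∫ v, u z.1 v ∂ρW) ^ 2
          + (∫ y, u y z.2 ∂ρX) ^ 2 + c ^ 2) ∂(ρX.prod ρW) := by
        refine integral_mono_of_nonneg (ae_of_all _ fun _ => sq_nonneg _) (hsum.const_mul 4)
          (ae_of_all _ fun z => ?_)
        simp only [doublyCentered, ← hc]
        generalize u z.1 z.2 = a
        generalize ∫ v, u z.1 v ∂ρW = b
        generalize ∫ y, u y z.2 ∂ρX = d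
        nlinarith [sq_nonneg (a + b), sq_nonneg (a + d), sq_nonneg (a - c), sq_nonneg (b - d),
          sq_nonneg (b + c), sq_nonneg (d + c)]
    _ = 4 * (A + ∫ z, (∫ v, u z.1 v ∂ρW) ^ 2 ∂(ρX.prod ρW)
          + ∫ z, (∫ y, u y z.2 ∂ρX) ^ 2 ∂(ρX.prod ρW) + c ^ 2) := by
        rw [integral_const_mul, integral_add j2 (integrable_const _), integral_add j1 i2, integral_add i0 i1,
          integral_const, probReal_univ, one_smul]
    _ ≤ 16 * A := by linarith

end Centering

/-! ### Truncation at level PQ, Chebyshev and Borel–Cantelli. -/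

section Truncation

/-- The cost of truncating the value `v` at level `M`: the normalised square of a small value, or
the level itself for a large value. -/
noncomputable def truncationCost (M v : ℝ) : ℝ := if v ≤ M then v ^ 2 / M else M

theorem measurable_truncationCost (M : ℝ) : Measurable (truncationCost M) :=
  Measurable.ite measurableSet_Iic (by fun_prop) measurable_const

theorem truncationCost_nonneg {M v : ℝ} (hM : 0 ≤ M) : 0 ≤ truncationCost M v := by
  unfold truncationCost; split_ifs <;> positivity

theorem abs_truncationCost_le {M v : ℝ} (hM : 0 < M) (hv : 0 ≤ v) : |truncationCost M v| ≤ M := by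
  rw [abs_of_nonneg (truncationCost_nonneg hM.le)]
  unfold truncationCost
  split_ifs with h
  · rw [div_le_iff₀ hM, sq]
    exact mul_le_mul h h hv hM.le
  · exact le_rfl

variable {X W Ω : Type*} [MeasurableSpace X] [MeasurableSpace W] [MeasurableSpace Ω]
  {ρX : Measure X} {ρW : Measure W} {μ : Measure Ω} [IsProbabilityMeasure μ]
  {x : ℕ → Ω → X} {w : ℕ → Ω → W}

/-- The truncation of `f` at level `M`. -/
noncomputable def truncateAt (M : ℝ) {X W : Type*} (f : X → W → ℝ) (y : X) (v : W) : ℝ :=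
  if f y v ≤ M then f y v else 0

theorem measurable_truncateAt {f : X → W → ℝ} (hf : Measurable fun z : X × W => f z.1 z.2) (M : ℝ) :
    Measurable fun z : X × W => truncateAt M f z.1 z.2 :=
  Measurable.ite (hf measurableSet_Iic) hf measurable_const

theorem truncateAt_nonneg {X W : Type*} {f : X → W → ℝ} (hf0 : ∀ y v, 0 ≤ f y v) (M : ℝ)
    (y : X) (v : W) : 0 ≤ truncateAt M f y v := by
  unfold truncateAt; split_ifs
  exacts [hf0 y v, le_rfl]

theorem truncateAt_le {X W : Type*} {f : X → W → ℝ} (hf0 : ∀ y v, 0 ≤ f y v) (M : ℝ)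
    (y : X) (v : W) : truncateAt M f y v ≤ f y v := by
  unfold truncateAt; split_ifs
  exacts [le_rfl, hf0 y v]

theorem abs_truncateAt_le {X W : Type*} {f : X → W → ℝ} (hf0 : ∀ y v, 0 ≤ f y v) {M : ℝ} (hM : 0 ≤ M)
    (y : X) (v : W) : |truncateAt M f y v| ≤ M := by
  rw [abs_of_nonneg (truncateAt_nonneg hf0 M y v)]
  unfold truncateAt; split_ifs with h
  exacts [h, hM]

/-- A union bound over the PQ entries gives PQ times the probability that f > PQ, which is the
integral of the cost over the large values. -/
theorem IsIIDSampling.measure_exists_lt_le (h : IsIIDSampling ρX ρW μ x w) {f : X → W → ℝ}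
    (hf : Measurable fun z : X × W => f z.1 z.2) (P Q : ℕ) :
    μ {ω | ∃ p < P, ∃ q < Q, (P * Q : ℝ) < f (x p ω) (w q ω)}
      ≤ ∫⁻ z, ENNReal.ofReal (truncationCost (P * Q) (f z.1 z.2)) ∂(ρX.prod ρW) := by
  set M : ℝ := P * Q with hM
  have hS : MeasurableSet {z : X × W | M < f z.1 z.2} := hf measurableSet_Ioi
  have e : ∀ p q, μ {ω | M < f (x p ω) (w q ω)} = (ρX.prod ρW) {z | M < f z.1 z.2} :=
    fun p q => (h.measurePreserving p q).measure_preimage hS.nullMeasurableSet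
  calc μ {ω | ∃ p < P, ∃ q < Q, M < f (x p ω) (w q ω)}
      ≤ μ (⋃ a ∈ Finset.range P ×ˢ Finset.range Q, {ω | M < f (x a.1 ω) (w a.2 ω)}) := by
        refine measure_mono ?_
        rintro ω ⟨p, hp, q, hq, hpq⟩
        simp only [Set.mem_iUnion]
        exact ⟨(p, q), by simp [hp, hq], hpq⟩
    _ ≤ ∑ a ∈ Finset.range P ×ˢ Finset.range Q, μ {ω | M < f (x a.1 ω) (w a.2 ω)} :=
        measure_biUnion_finset_le _ _
    _ = ENNReal.ofReal M * (ρX.prod ρW) {z | M < f z.1 z.2} := by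
        simp_rw [e]
        simp [hM, ENNReal.ofReal_mul]
    _ = ∫⁻ z in {z | M < f z.1 z.2}, ENNReal.ofReal M ∂(ρX.prod ρW) := by simp
    _ ≤ ∫⁻ z in {z | M < f z.1 z.2}, ENNReal.ofReal (truncationCost M (f z.1 z.2)) ∂(ρX.prod ρW) := by
        refine setLIntegral_mono' hS fun z hz => ?_
        have : ¬ f z.1 z.2 ≤ M := not_le.2 hz
        simp [truncationCost, this]
    _ ≤ _ := setLIntegral_le_lintegral _ _

variable [IsProbabilityMeasure ρX] [IsProbabilityMeasure ρW]

/-- Chebyshev: the second moment of the average is at most 16/(PQ) times that of the truncated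
function, and the latter over PQ is the integral of the cost over the small values. -/
theorem IsIIDSampling.measure_le_gridAverage_doublyCentered_le (h : IsIIDSampling ρX ρW μ x w)
    {f : X → W → ℝ} (hf : Measurable fun z : X × W => f z.1 z.2) (hf0 : ∀ y v, 0 ≤ f y v)
    {P Q : ℕ} (hP : 0 < P) (hQ : 0 < Q) {ε : ℝ} (hε : 0 < ε) :
    μ {ω | ε ≤ gridAverage (doublyCentered ρX ρW (truncateAt (P * Q) f)) (x · ω) (w · ω) P Q}
      ≤ ENNReal.ofReal (16 / ε ^ 2) *
        ∫⁻ z, ENNReal.ofReal (truncationCost (P * Q) (f z.1 z.2)) ∂(ρX.prod ρW) := by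
  set M : ℝ := P * Q with hM
  have hM0 : 0 < M := by positivity
  set u := truncateAt M f
  have mu : Measurable fun z : X × W => u z.1 z.2 := measurable_truncateAt hf M
  have bu : ∀ y v, |u y v| ≤ M := abs_truncateAt_le hf0 hM0.le
  set g := doublyCentered ρX ρW u
  have mg : Measurable fun z : X × W => g z.1 z.2 := measurable_doublyCentered ρX ρW mu
  have bg : ∀ y v, |g y v| ≤ 4 * M := abs_doublyCentered_le ρX ρW bu
  set G : Ω → ℝ := fun ω => gridAverage g (x · ω) (w · ω) P Q
  have mG : Measurable G := by
    refine Measurable.div_const (Finset.measurable_sum _ fun p _ =>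
      Finset.measurable_sum _ fun q _ => ?_) _
    exact mg.comp ((h.measurable_input p).prodMk (h.measurable_feature q))
  have bG : ∀ ω, |G ω| ≤ 4 * M := by
    intro ω
    have : |∑ p ∈ Finset.range P, ∑ q ∈ Finset.range Q, g (x p ω) (w q ω)|
        ≤ ∑ p ∈ Finset.range P, ∑ q ∈ Finset.range Q, 4 * M :=
      (Finset.abs_sum_le_sum_abs _ _).trans (Finset.sum_le_sum fun p _ =>
        (Finset.abs_sum_le_sum_abs _ _).trans (Finset.sum_le_sum fun q _ => bg _ _))
    simp only [Finset.sum_const, Finset.card_range, nsmul_eq_mul] at this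
    simp only [G, gridAverage]
    rw [abs_div, abs_of_pos hM0, div_le_iff₀ hM0]
    calc _ ≤ _ := this
      _ = _ := by rw [hM]; ring
  have iG : Integrable (fun ω => G ω ^ 2) μ :=
    (MemLp.of_bound mG.aestronglyMeasurable (4 * M) (ae_of_all _ bG)).integrable_sq
  have icost : Integrable (fun z : X × W => truncationCost M (f z.1 z.2)) (ρX.prod ρW) :=
    integrable_of_abs_le _ ((measurable_truncationCost M).comp hf)
      fun z => abs_truncationCost_le hM0 (hf0 _ _)
  have sG : ∫ ω, G ω ^ 2 ∂μ ≤ 16 * ∫ z, truncationCost M (f z.1 z.2) ∂(ρX.prod ρW) := by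
    have e1 := h.integral_gridAverage_sq mg bg (integral_doublyCentered_left ρX ρW mu bu)
      (integral_doublyCentered_right ρX ρW mu bu) P Q
    have e2 := integral_doublyCentered_sq_le ρX ρW mu bu
    have e3 : (∫ z, u z.1 z.2 ^ 2 ∂(ρX.prod ρW)) / M
        ≤ ∫ z, truncationCost M (f z.1 z.2) ∂(ρX.prod ρW) := by
      rw [← integral_div]
      refine integral_mono_of_nonneg (ae_of_all _ fun _ => by positivity) ?_ (ae_of_all _ fun z => ?_)
      · exact icost
      · simp only [u, truncateAt, truncationCost]
        split_ifs
        · exact le_rfl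
        · simpa using hM0.le
    calc ∫ ω, G ω ^ 2 ∂μ = (∫ z, g z.1 z.2 ^ 2 ∂(ρX.prod ρW)) / M := e1
      _ ≤ (16 * ∫ z, u z.1 z.2 ^ 2 ∂(ρX.prod ρW)) / M := by gcongr
      _ = 16 * ((∫ z, u z.1 z.2 ^ 2 ∂(ρX.prod ρW)) / M) := by ring
      _ ≤ _ := by gcongr
  have hcost : ENNReal.ofReal (∫ z, truncationCost M (f z.1 z.2) ∂(ρX.prod ρW))
      = ∫⁻ z, ENNReal.ofReal (truncationCost M (f z.1 z.2)) ∂(ρX.prod ρW) :=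
    ofReal_integral_eq_lintegral_ofReal icost
      (ae_of_all _ fun z => truncationCost_nonneg hM0.le)
  have cheb := mul_meas_ge_le_integral_of_nonneg (μ := μ) (ae_of_all _ fun ω => sq_nonneg (G ω)) iG
    (ε ^ 2)
  have h1 : μ.real {ω | ε ≤ G ω} ≤ 16 / ε ^ 2 * ∫ z, truncationCost M (f z.1 z.2) ∂(ρX.prod ρW) := by
    have : μ.real {ω | ε ≤ G ω} ≤ μ.real {ω | ε ^ 2 ≤ G ω ^ 2} :=
      measureReal_mono fun ω (hω : ε ≤ G ω) => pow_le_pow_left₀ hε.le hω 2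
    rw [div_mul_eq_mul_div, le_div_iff₀ (by positivity), mul_comm]
    calc _ ≤ ε ^ 2 * μ.real {ω | ε ^ 2 ≤ G ω ^ 2} := by gcongr
      _ ≤ _ := cheb.trans sG
  rw [← hcost, ← ENNReal.ofReal_mul (by positivity)]
  rw [← ENNReal.ofReal_toReal (measure_ne_top μ {ω | ε ≤ G ω})]
  exact ENNReal.ofReal_le_ofReal h1

/-- Only an upper bound is needed. So after Borel–Cantelli the truncated row and column means may be
replaced by the larger untruncated ones, and the grand mean, which enters with a minus sign,
dropped. -/
theorem IsIIDSampling.ae_eventually_gridAverage_le (h : IsIIDSampling ρX ρW μ x w)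
    {f : X → W → ℝ} (hf : Measurable fun z : X × W => f z.1 z.2) (hf0 : ∀ y v, 0 ≤ f y v)
    (hfi : Integrable (fun z : X × W => f z.1 z.2) (ρX.prod ρW))
    {J : Type*} [Countable J] {P Q : J → ℕ} (hP : ∀ j, 0 < P j) (hQ : ∀ j, 0 < Q j)
    (hT : ∑' j, ∫⁻ z, ENNReal.ofReal (truncationCost (P j * Q j) (f z.1 z.2)) ∂(ρX.prod ρW) ≠ ⊤)
    {ε : ℝ} (hε : 0 < ε) :
    ∀ᵐ ω ∂μ, ∀ᶠ j in cofinite, gridAverage f (x · ω) (w · ω) (P j) (Q j) ≤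
      (∑ p ∈ Finset.range (P j), ∫ v, f (x p ω) v ∂ρW) / P j +
      (∑ q ∈ Finset.range (Q j), ∫ y, f y (w q ω) ∂ρX) / Q j + ε := by
  have b1 : ∀ᵐ ω ∂μ, ∀ᶠ j in cofinite,
      ¬ ∃ p < P j, ∃ q < Q j, (P j * Q j : ℝ) < f (x p ω) (w q ω) := by
    have := ae_finite_setOfPred_mem (μ := μ)
      (s := fun j => {ω | ∃ p < P j, ∃ q < Q j, (P j * Q j : ℝ) < f (x p ω) (w q ω)})
      (ne_top_of_le_ne_top hT (ENNReal.tsum_le_tsum fun j => h.measure_exists_lt_le hf _ _))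
    filter_upwards [this] with ω hω
    rw [eventually_cofinite]
    simpa using hω
  have b2 : ∀ᵐ ω ∂μ, ∀ᶠ j in cofinite,
      ¬ ε ≤ gridAverage (doublyCentered ρX ρW (truncateAt (P j * Q j) f)) (x · ω) (w · ω)
        (P j) (Q j) := by
    have := ae_finite_setOfPred_mem (μ := μ)
      (s := fun j => {ω | ε ≤ gridAverage (doublyCentered ρX ρW (truncateAt (P j * Q j) f))
        (x · ω) (w · ω) (P j) (Q j)}) (by
      refine ne_top_of_le_ne_top ?_ (ENNReal.tsum_le_tsum fun j =>
        h.measure_le_gridAverage_doublyCentered_le hf hf0 (hP j) (hQ j) hε)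
      rw [ENNReal.tsum_mul_left]
      exact ENNReal.mul_ne_top ENNReal.ofReal_ne_top hT)
    filter_upwards [this] with ω hω
    rw [eventually_cofinite]
    simpa using hω
  have b3 : ∀ᵐ ω ∂μ, ∀ p, Integrable (f (x p ω)) ρW := by
    rw [ae_all_iff]
    intro p
    have : ∀ᵐ y ∂ρX, Integrable (f y) ρW := hfi.prod_right_ae
    rw [← h.law_input p] at this
    exact ae_of_ae_map (h.measurable_input p).aemeasurable this
  have b4 : ∀ᵐ ω ∂μ, ∀ q, Integrable (fun y => f y (w q ω)) ρX := by
    rw [ae_all_iff]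
    intro q
    have : ∀ᵐ v ∂ρW, Integrable (fun y => f y v) ρX := hfi.prod_left_ae
    rw [← h.law_feature q] at this
    exact ae_of_ae_map (h.measurable_feature q).aemeasurable this
  filter_upwards [b1, b2, b3, b4] with ω e1 e2 e3 e4
  filter_upwards [e1, e2] with j h1 h2
  push Not at h1 h2
  set u := truncateAt (P j * Q j : ℝ) f with hu
  have hfu : gridAverage f (x · ω) (w · ω) (P j) (Q j)
      = gridAverage u (x · ω) (w · ω) (P j) (Q j) := by
    unfold gridAverage
    congr 1
    refine Finset.sum_congr rfl fun p hp => Finset.sum_congr rfl fun q hq => ?_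
    rw [hu, truncateAt, if_pos (h1 p (Finset.mem_range.1 hp) q (Finset.mem_range.1 hq))]
  have u0 := truncateAt_nonneg hf0 (P j * Q j)
  have uf := truncateAt_le hf0 (P j * Q j)
  have i1 : ∀ p, ∫ v, u (x p ω) v ∂ρW ≤ ∫ v, f (x p ω) v ∂ρW := fun p =>
    integral_mono_of_nonneg (ae_of_all _ fun v => u0 _ v) (e3 p) (ae_of_all _ fun v => uf _ v)
  have i2 : ∀ q, ∫ y, u y (w q ω) ∂ρX ≤ ∫ y, f y (w q ω) ∂ρX := fun q =>
    integral_mono_of_nonneg (ae_of_all _ fun y => u0 y _) (e4 q) (ae_of_all _ fun y => uf y _)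
  have i3 : 0 ≤ ∫ z, u z.1 z.2 ∂(ρX.prod ρW) := integral_nonneg fun z => u0 _ _
  have s1 : (∑ p ∈ Finset.range (P j), ∫ v, u (x p ω) v ∂ρW) / P j
      ≤ (∑ p ∈ Finset.range (P j), ∫ v, f (x p ω) v ∂ρW) / P j :=
    div_le_div_of_nonneg_right (Finset.sum_le_sum fun p _ => i1 p) (Nat.cast_nonneg _)
  have s2 : (∑ q ∈ Finset.range (Q j), ∫ y, u y (w q ω) ∂ρX) / Q j
      ≤ (∑ q ∈ Finset.range (Q j), ∫ y, f y (w q ω) ∂ρX) / Q j :=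
    div_le_div_of_nonneg_right (Finset.sum_le_sum fun q _ => i2 q) (Nat.cast_nonneg _)
  rw [hfu, gridAverage_eq_doublyCentered ρX ρW u _ _ (hP j) (hQ j)]
  linarith

end Truncation

/-! ### Summability over dyadic sizes and passage to all sizes. -/

section Dyadic

theorem sum_range_truncationCost_le {v : ℝ} (hv : 0 ≤ v) (N : ℕ) :
    ∑ k ∈ Finset.range N, truncationCost (2 ^ k) v ≤ 4 * v := by
  -- The levels below v contribute a geometric sum of the 2^k, the later ones a geometric tail of v²
  -- / 2^k. Keeping the unused part of the tail, 2v² / 2^N, makes the induction close.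
  have key : (v ≤ 2 ^ N → ∑ k ∈ Finset.range N, truncationCost (2 ^ k) v ≤ 4 * v - 2 * (v ^ 2 / 2 ^ N)) ∧
      (2 ^ N < v → ∑ k ∈ Finset.range N, truncationCost (2 ^ k) v ≤ 2 ^ N) := by
    induction N with
    | zero =>
      refine ⟨fun h => ?_, fun _ => by simp⟩
      simp only [pow_zero, Finset.range_zero, Finset.sum_empty, div_one] at h ⊢
      nlinarith
    | succ N ih =>
      rw [Finset.sum_range_succ]
      have h2 : (0 : ℝ) < 2 ^ N := by positivity
      rcases le_or_gt v (2 ^ N) with h | h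
      · have e : truncationCost (2 ^ N) v = v ^ 2 / 2 ^ N := if_pos h
        have e2 : 2 * (v ^ 2 / 2 ^ (N + 1)) = v ^ 2 / 2 ^ N := by
          rw [pow_succ]; field_simp; ring
        refine ⟨fun _ => ?_, fun h' => ?_⟩
        · rw [e, e2]; linarith [ih.1 h]
        · rw [pow_succ] at h'; linarith
      · have e : truncationCost (2 ^ N) v = 2 ^ N := if_neg h.not_ge
        have h3 := ih.2 h
        rw [e]
        refine ⟨fun h' => ?_, fun _ => by rw [pow_succ]; linarith⟩
        have : 2 * (v ^ 2 / 2 ^ (N + 1)) ≤ 2 * v := by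
          have : v ^ 2 / 2 ^ (N + 1) ≤ v := by
            rw [div_le_iff₀ (by positivity), sq]; gcongr
          linarith
        linarith
  rcases le_or_gt v (2 ^ N) with h | h
  · have := key.1 h
    have : 0 ≤ v ^ 2 / 2 ^ N := by positivity
    linarith
  · linarith [key.2 h]

theorem tsum_ofReal_truncationCost_le {v : ℝ} (hv : 0 ≤ v) :
    ∑' k : ℕ, ENNReal.ofReal (truncationCost (2 ^ k) v) ≤ ENNReal.ofReal (4 * v) := by
  rw [ENNReal.tsum_eq_iSup_nat]
  refine iSup_le fun N => ?_
  rw [← ENNReal.ofReal_sum_of_nonneg fun k _ => truncationCost_nonneg (by positivity)]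
  exact ENNReal.ofReal_le_ofReal (sum_range_truncationCost_le hv N)

theorem truncationCost_le {M v : ℝ} (hM : 0 < M) : truncationCost M v ≤ v ^ 2 / M := by
  unfold truncationCost
  split_ifs with h
  · exact le_rfl
  · rw [le_div_iff₀ hM]
    nlinarith

theorem gridAverage_le_four_mul {X W : Type*} {f : X → W → ℝ} (hf0 : ∀ y v, 0 ≤ f y v) (x : ℕ → X)
    (w : ℕ → W) {P Q : ℕ} (hP : 0 < P) (hQ : 0 < Q) :
    gridAverage f x w P Q
      ≤ 4 * gridAverage f x w (2 ^ (Nat.log 2 P + 1)) (2 ^ (Nat.log 2 Q + 1)) := by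
  have h1 : ∀ {P : ℕ}, P ≤ 2 ^ (Nat.log 2 P + 1) :=
    fun {P} => (Nat.lt_pow_succ_log_self one_lt_two P).le
  have h2 : ∀ {P : ℕ}, 0 < P → ((2 ^ (Nat.log 2 P + 1) : ℕ) : ℝ) ≤ 2 * P := by
    intro P hP
    have := Nat.pow_log_le_self 2 hP.ne'
    have h : 2 ^ (Nat.log 2 P + 1) ≤ 2 * P := by rw [pow_succ]; omega
    exact_mod_cast h
  have hP2 := h2 hP
  have hQ2 := h2 hQ
  set P' := 2 ^ (Nat.log 2 P + 1) with hP'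
  set Q' := 2 ^ (Nat.log 2 Q + 1) with hQ'
  have p0 : 0 < P' := by positivity
  have q0 : 0 < Q' := by positivity
  set S := ∑ p ∈ Finset.range P', ∑ q ∈ Finset.range Q', f (x p) (w q)
  have hS0 : 0 ≤ S := Finset.sum_nonneg fun _ _ => Finset.sum_nonneg fun _ _ => hf0 _ _
  have hS : ∑ p ∈ Finset.range P, ∑ q ∈ Finset.range Q, f (x p) (w q) ≤ S :=
    (Finset.sum_le_sum fun p _ => Finset.sum_le_sum_of_subset_of_nonneg
      (Finset.range_mono h1) fun _ _ _ => hf0 _ _).trans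
    (Finset.sum_le_sum_of_subset_of_nonneg (Finset.range_mono h1)
      fun _ _ _ => Finset.sum_nonneg fun _ _ => hf0 _ _)
  simp only [gridAverage]
  calc _ ≤ S / (P * Q) := by gcongr
    _ = 4 * S / ((2 * P) * (2 * Q)) := by field_simp; norm_num
    _ ≤ 4 * S / (P' * Q') := by gcongr
    _ = _ := by ring

/-- The visited pairs form a chain for the product order, and two comparable pairs with equal
coordinate sums coincide. Thus each truncation level 2^(a+b) is used by at most one dyadic size. -/
theorem exists_injective_add_of_monotone {A B : ℕ → ℕ} (hA : Monotone A) (hB : Monotone B) :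
    ∃ J : Set (ℕ × ℕ), (∀ t, (A t, B t) ∈ J) ∧ Function.Injective fun j : J => j.1.1 + j.1.2 := by
  refine ⟨Set.range fun t => (A t, B t), fun t => Set.mem_range_self t, ?_⟩
  rintro ⟨_, s, rfl⟩ ⟨_, t, rfl⟩ hst
  simp only at hst
  refine Subtype.ext (Prod.ext_iff.2 ?_)
  change A s = A t ∧ B s = B t
  rcases le_total s t with hle | hle
  · have := hA hle; have := hB hle; omega
  · have := hA hle; have := hB hle; omega

variable {X W Ω : Type*} [MeasurableSpace X] [MeasurableSpace W] [MeasurableSpace Ω]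
  {ρX : Measure X} {ρW : Measure W} {μ : Measure Ω} [IsProbabilityMeasure ρX]
  [IsProbabilityMeasure ρW] [IsProbabilityMeasure μ]
  {x : ℕ → Ω → X} {w : ℕ → Ω → W}

/-- The constant is 20 = 4 · (2 + 2 + 1): rounding both sizes up to powers of two costs a factor 4,
the row and column means are each eventually at most 2ε, and the centred part adds ε. -/
theorem IsIIDSampling.ae_eventually_gridAverage_le_of_tsum_ne_top (h : IsIIDSampling ρX ρW μ x w)
    {f : X → W → ℝ} (hf : Measurable fun z : X × W => f z.1 z.2) (hf0 : ∀ y v, 0 ≤ f y v)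
    (hfi : Integrable (fun z : X × W => f z.1 z.2) (ρX.prod ρW)) {ε : ℝ} (hε : 0 < ε)
    (hfε : ∫ z, f z.1 z.2 ∂(ρX.prod ρW) ≤ ε)
    (J : Set (ℕ × ℕ))
    (hT : ∑' j : J, ∫⁻ z, ENNReal.ofReal (truncationCost (2 ^ (j.1.1 + j.1.2)) (f z.1 z.2))
      ∂(ρX.prod ρW) ≠ ⊤)
    {ι : Type*} {L : Filter ι} {u : ι → ℕ × ℕ} (hu : Tendsto u L (atTop ×ˢ atTop))
    (huJ : ∀ t, (Nat.log 2 (u t).1 + 1, Nat.log 2 (u t).2 + 1) ∈ J) :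
    ∀ᵐ ω ∂μ, ∀ᶠ t in L, gridAverage f (x · ω) (w · ω) (u t).1 (u t).2 ≤ 20 * ε := by
  have h1 := h.ae_eventually_gridAverage_le hf hf0 hfi (J := J) (P := fun j => 2 ^ j.1.1)
    (Q := fun j => 2 ^ j.1.2) (fun j => by positivity) (fun j => by positivity)
    (by simpa only [Nat.cast_pow, Nat.cast_ofNat, ← pow_add] using hT) hε
  have h2 := h.ae_tendsto_average (measurable_integral_left ρW hf) hfi.integral_prod_left
  have h3 := h.swap.ae_tendsto_average (measurable_integral_right ρX hf) hfi.integral_prod_right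
  rw [← integral_prod _ hfi] at h2
  rw [← integral_prod_symm _ hfi] at h3
  have u1 : Tendsto (fun t => (u t).1) L atTop := tendsto_fst.comp hu
  have u2 : Tendsto (fun t => (u t).2) L atTop := tendsto_snd.comp hu
  have hlog : Tendsto (fun P : ℕ => Nat.log 2 P + 1) atTop atTop :=
    tendsto_atTop_atTop.2 fun b => ⟨2 ^ b, fun a hba =>
      (Nat.le_log_of_pow_le one_lt_two hba).trans (Nat.le_succ _)⟩
  have l1 := hlog.comp u1
  have l2 := hlog.comp u2
  -- Each dyadic index is eventually left for good, because its first coordinate tends to infinity;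
  -- this transfers Borel–Cantelli to `L`.
  have hcof : Tendsto (fun t => (⟨_, huJ t⟩ : J)) L cofinite := by
    refine le_cofinite_iff_eventually_ne.2 fun j => ?_
    rw [eventually_map]
    filter_upwards [l1.eventually_gt_atTop j.1.1] with t ht hj
    rw [← hj] at ht
    exact lt_irrefl _ ht
  have hpow : Tendsto (fun a : ℕ => 2 ^ a) atTop atTop := tendsto_pow_atTop_atTop_of_one_lt one_lt_two
  filter_upwards [h1, h2, h3] with ω e1 e2 e3
  have f2 := (e2.comp (hpow.comp l1)).eventually_le_const
    (u := 2 * ε) (by linarith)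
  have f3 := (e3.comp (hpow.comp l2)).eventually_le_const
    (u := 2 * ε) (by linarith)
  filter_upwards [hcof.eventually e1, f2, f3, u1.eventually_gt_atTop 0, u2.eventually_gt_atTop 0]
    with t g1 g2 g3 g4 g5
  refine (gridAverage_le_four_mul hf0 _ _ g4 g5).trans ?_
  simp only [Function.comp_apply] at g2 g3
  linarith

theorem IsIIDSampling.ae_eventually_gridAverage_le_of_monotone (h : IsIIDSampling ρX ρW μ x w)
    {f : X → W → ℝ} (hf : Measurable fun z : X × W => f z.1 z.2) (hf0 : ∀ y v, 0 ≤ f y v)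
    (hfi : Integrable (fun z : X × W => f z.1 z.2) (ρX.prod ρW)) {ε : ℝ} (hε : 0 < ε)
    (hfε : ∫ z, f z.1 z.2 ∂(ρX.prod ρW) ≤ ε) {P Q : ℕ → ℕ} (hP : Monotone P) (hQ : Monotone Q)
    (hP' : Tendsto P atTop atTop) (hQ' : Tendsto Q atTop atTop) :
    ∀ᵐ ω ∂μ, ∀ᶠ t in atTop, gridAverage f (x · ω) (w · ω) (P t) (Q t) ≤ 20 * ε := by
  have hlog : Monotone fun P : ℕ => Nat.log 2 P + 1 :=
    fun P Q hPQ => Nat.succ_le_succ (Nat.log_mono_right hPQ)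
  obtain ⟨J, hJ, hinj⟩ := exists_injective_add_of_monotone (hlog.comp hP) (hlog.comp hQ)
  refine h.ae_eventually_gridAverage_le_of_tsum_ne_top hf hf0 hfi hε hfε J ?_
    (u := fun t => (P t, Q t)) (hP'.prodMk hQ') hJ
  refine ne_top_of_le_ne_top ?_ (ENNReal.tsum_comp_le_tsum_of_injective hinj fun k =>
    ∫⁻ z, ENNReal.ofReal (truncationCost (2 ^ k) (f z.1 z.2)) ∂(ρX.prod ρW))
  have hm : ∀ k : ℕ, Measurable fun z : X × W =>
      ENNReal.ofReal (truncationCost (2 ^ k) (f z.1 z.2)) :=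
    fun k => ((measurable_truncationCost _).comp hf).ennreal_ofReal
  rw [← lintegral_tsum fun k => (hm k).aemeasurable]
  refine ne_top_of_le_ne_top ?_ (lintegral_mono fun z => tsum_ofReal_truncationCost_le (hf0 z.1 z.2))
  exact (hfi.const_mul 4).lintegral_lt_top.ne

theorem IsIIDSampling.ae_eventually_gridAverage_le_of_memLp_two (h : IsIIDSampling ρX ρW μ x w)
    {f : X → W → ℝ} (hf : Measurable fun z : X × W => f z.1 z.2) (hf0 : ∀ y v, 0 ≤ f y v)
    (hfi : MemLp (fun z : X × W => f z.1 z.2) 2 (ρX.prod ρW)) {ε : ℝ} (hε : 0 < ε)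
    (hfε : ∫ z, f z.1 z.2 ∂(ρX.prod ρW) ≤ ε) :
    ∀ᵐ ω ∂μ, ∀ᶠ p : ℕ × ℕ in atTop ×ˢ atTop,
      gridAverage f (x · ω) (w · ω) p.1 p.2 ≤ 20 * ε := by
  refine h.ae_eventually_gridAverage_le_of_tsum_ne_top hf hf0 (hfi.integrable one_le_two) hε hfε
    Set.univ ?_ tendsto_id fun t => Set.mem_univ _
  have hle : ∀ j : (Set.univ : Set (ℕ × ℕ)),
      ∫⁻ z, ENNReal.ofReal (truncationCost (2 ^ (j.1.1 + j.1.2)) (f z.1 z.2)) ∂(ρX.prod ρW)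
      ≤ ((2 : ENNReal)⁻¹ ^ j.1.1 * (2 : ENNReal)⁻¹ ^ j.1.2) *
        ∫⁻ z, ENNReal.ofReal (f z.1 z.2 ^ 2) ∂(ρX.prod ρW) := by
    intro j
    rw [← lintegral_const_mul _ (hf.pow_const 2).ennreal_ofReal]
    refine lintegral_mono fun z => ?_
    refine (ENNReal.ofReal_le_ofReal (truncationCost_le (by positivity))).trans (le_of_eq ?_)
    rw [ENNReal.ofReal_div_of_pos (by positivity), ← pow_add, mul_comm, div_eq_mul_inv,
      ENNReal.ofReal_pow zero_le_two, ENNReal.inv_pow]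
    simp
  refine ne_top_of_le_ne_top ?_ (ENNReal.tsum_le_tsum hle)
  rw [ENNReal.tsum_mul_right]
  refine ENNReal.mul_ne_top ?_ hfi.integrable_sq.lintegral_lt_top.ne
  refine ne_top_of_le_ne_top ?_ (ENNReal.tsum_comp_le_tsum_of_injective Subtype.val_injective
    fun j : ℕ × ℕ => (2 : ENNReal)⁻¹ ^ j.1 * (2 : ENNReal)⁻¹ ^ j.2)
  -- The sum of 2^(-a-b) over all pairs is a product of two convergent geometric series.
  rw [ENNReal.tsum_prod (f := fun a b : ℕ => (2 : ENNReal)⁻¹ ^ a * (2 : ENNReal)⁻¹ ^ b)]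
  simp_rw [ENNReal.tsum_mul_left, ENNReal.tsum_mul_right]
  rw [ENNReal.tsum_geometric]
  simp
  exact ENNReal.mul_ne_top (by simp) (by simp)

end Dyadic

/-! ### Exchange of limits under uniform approximation. -/

section Approximation

theorem tendsto_of_approx {ι : Type*} {L : Filter ι} {F : ι → ℝ} {G : ℕ → ι → ℝ} {m : ℕ → ℝ}
    {δ : ℕ → ℝ} {m₀ : ℝ} (hδ : Tendsto δ atTop (𝓝 0)) (hm : Tendsto m atTop (𝓝 m₀))
    (hG : ∀ k, Tendsto (G k) L (𝓝 (m k))) (hF : ∀ k, ∀ᶠ t in L, |F t - G k t| ≤ δ k) :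
    Tendsto F L (𝓝 m₀) := by
  rw [Metric.tendsto_nhds]
  intro ε hε
  have h1 := hδ.eventually_lt_const (show (0 : ℝ) < ε / 3 by positivity)
  have h2 := Metric.tendsto_nhds.1 hm (ε / 3) (by positivity)
  obtain ⟨k, hk1, hk2⟩ := (h1.and h2).exists
  have h3 := Metric.tendsto_nhds.1 (hG k) (ε / 3) (by positivity)
  filter_upwards [h3, hF k] with t ht1 ht2
  rw [Real.dist_eq] at *
  have := abs_sub_le (F t) (G k t) m₀
  have := abs_sub_le (G k t) (m k) m₀
  linarith

/-- The limits of the approximants form a Cauchy sequence. This version serves when the limit is not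
known beforehand, as with one sample size held fixed. -/
theorem exists_tendsto_of_approx {ι : Type*} {L : Filter ι} [L.NeBot] {F : ι → ℝ}
    {G : ℕ → ι → ℝ} {δ : ℕ → ℝ} (hδ : Tendsto δ atTop (𝓝 0))
    (hG : ∀ k, ∃ m, Tendsto (G k) L (𝓝 m)) (hF : ∀ k, ∀ᶠ t in L, |F t - G k t| ≤ δ k) :
    ∃ m₀, Tendsto F L (𝓝 m₀) := by
  choose m hm using hG
  have hc : ∀ j k, |m j - m k| ≤ δ j + δ k := by
    intro j k
    refine le_of_tendsto ((hm j).sub (hm k)).abs ?_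
    filter_upwards [hF j, hF k] with t h1 h2
    have := abs_sub_le (G j t) (F t) (G k t)
    rw [abs_sub_comm] at h1
    linarith
  have hcau : CauchySeq m := by
    rw [Metric.cauchySeq_iff']
    intro ε hε
    obtain ⟨N, hN⟩ := eventually_atTop.1 (hδ.eventually_lt_const (show (0 : ℝ) < ε / 2 by positivity))
    refine ⟨N, fun k hk => ?_⟩
    rw [Real.dist_eq]
    have := hc k N
    have := hN k hk
    have := hN N le_rfl
    linarith
  obtain ⟨m₀, h₀⟩ := cauchySeq_tendsto_of_complete hcau
  exact ⟨m₀, tendsto_of_approx hδ h₀ hm hF⟩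

variable {X W : Type*}

theorem gridAverage_eq_matrixAverage (f : X → W → ℝ) (x : ℕ → X) (w : ℕ → W) (P Q : ℕ) :
    gridAverage f x w P Q = matrixAverage (P := P) (Q := Q) fun i α => f (x i) (w α) := by
  simp [gridAverage, matrixAverage, Finset.sum_range]

theorem gridAverage_swap (f : X → W → ℝ) (x : ℕ → X) (w : ℕ → W) (P Q : ℕ) :
    gridAverage (fun v y => f y v) w x Q P = gridAverage f x w P Q := by
  rw [gridAverage, gridAverage, Finset.sum_comm, mul_comm]

theorem gridAverage_sq_le (f g : X → W → ℝ) (x : ℕ → X) (w : ℕ → W) (P Q : ℕ) :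
    gridAverage (fun y v => g y v ^ 2) x w P Q ≤ 2 * gridAverage (fun y v => f y v ^ 2) x w P Q
      + 2 * gridAverage (fun y v => (f y v - g y v) ^ 2) x w P Q := by
  simp only [gridAverage, ← mul_div_assoc, ← add_div, Finset.mul_sum, ← Finset.sum_add_distrib]
  gcongr with p _ q _
  nlinarith [sq_nonneg (2 * f (x p) (w q) - g (x p) (w q))]

/-- If the grid averages of `(φ - ψₖ)²` are eventually below `eₖ → 0`, then the estimators of `ψₖ`
approximate those of `φ` uniformly. -/
theorem exists_approx_momentEstimator {n : ℕ} (hn : 1 ≤ n) {φ : X → W → ℝ} {ψ : ℕ → X → W → ℝ}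
    {x : ℕ → X} {w : ℕ → W} {ι : Type*} {L : Filter ι} {u : ι → ℕ × ℕ} {A : ℝ} {e : ℕ → ℝ}
    (hA : ∀ᶠ t in L, gridAverage (fun y v => φ y v ^ 2) x w (u t).1 (u t).2 ≤ A)
    (he : ∀ k, ∀ᶠ t in L,
      gridAverage (fun y v => (φ y v - ψ k y v) ^ 2) x w (u t).1 (u t).2 ≤ e k)
    (he0 : Tendsto e atTop (𝓝 0)) :
    ∃ δ : ℕ → ℝ, Tendsto δ atTop (𝓝 0) ∧ ∀ k, ∀ᶠ t in L,
      |momentEstimator n (measurementMatrix φ x w (u t).1 (u t).2) -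
        momentEstimator n (measurementMatrix (ψ k) x w (u t).1 (u t).2)| ≤ δ k := by
  obtain ⟨D, hD⟩ := he0.bddAbove_range
  have hD' : ∀ k, e k ≤ |D| := fun k => (hD (Set.mem_range_self k)).trans (le_abs_self D)
  set B : ℝ := 2 * |A| + 2 * |D|
  refine ⟨fun k => (n ^ n * n.factorial : ℝ) ^ 2 * momentModulus n B (e k), ?_, fun k => ?_⟩
  · simpa using (tendsto_momentModulus n B he0).const_mul ((n ^ n * n.factorial : ℝ) ^ 2)
  · filter_upwards [hA, he k] with t h1 h2
    have h3 := gridAverage_sq_le φ (ψ k) x w (u t).1 (u t).2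
    have := le_abs_self A
    have := abs_nonneg A
    have := abs_nonneg D
    have := hD' k
    refine abs_momentEstimator_sub_le hn _ _ (B := B) ?_ ?_ ?_
    · exact (gridAverage_eq_matrixAverage (fun y v => φ y v ^ 2) x w _ _).symm.le.trans
        (by linarith)
    · exact (gridAverage_eq_matrixAverage (fun y v => ψ k y v ^ 2) x w _ _).symm.le.trans
        (by linarith)
    · exact (gridAverage_eq_matrixAverage (fun y v => (φ y v - ψ k y v) ^ 2) x w _ _).symm.le.trans
        h2

end Approximation

/-! ### Consistency along a general filter. -/

section Convergence

variable {X W Ω : Type*} [MeasurableSpace X] [MeasurableSpace W] [MeasurableSpace Ω]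
  {ρX : Measure X} {ρW : Measure W} {μ : Measure Ω} [IsProbabilityMeasure ρX]
  [IsProbabilityMeasure ρW]
  {x : ℕ → Ω → X} {w : ℕ → Ω → W}

theorem exists_seq_isSeparableSum {φ : X → W → ℝ}
    (hφ : MemLp (fun z : X × W => φ z.1 z.2) 2 (ρX.prod ρW)) :
    ∃ ψ : ℕ → X → W → ℝ, (∀ k, IsSeparableSum (ψ k)) ∧
      ∀ k, ∫ z, (φ z.1 z.2 - ψ k z.1 z.2) ^ 2 ∂(ρX.prod ρW) ≤ (1 / 2) ^ k := by
  choose ψ h1 h2 using fun k : ℕ => exists_isSeparableSum_integral_sq_sub_le ρX ρW hφ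
    (ε := (1 / 2) ^ k) (by positivity)
  exact ⟨ψ, h1, h2⟩

theorem integral_sq_le_two_mul_add {T : Type*} [MeasurableSpace T] {τ : Measure T} {f g : T → ℝ}
    (hf : MemLp f 2 τ) (hg : MemLp g 2 τ) :
    ∫ t, g t ^ 2 ∂τ ≤ 2 * ∫ t, f t ^ 2 ∂τ + 2 * ∫ t, (f t - g t) ^ 2 ∂τ := by
  have hd : Integrable (fun t => (f t - g t) ^ 2) τ := (hf.sub hg).integrable_sq
  rw [← integral_const_mul, ← integral_const_mul,
    ← integral_add (hf.integrable_sq.const_mul 2) (hd.const_mul 2)]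
  refine integral_mono hg.integrable_sq ((hf.integrable_sq.const_mul 2).add (hd.const_mul 2))
    fun t => ?_
  simp only []
  nlinarith [sq_nonneg (2 * f t - g t)]

theorem tendsto_spectralMoment {φ : X → W → ℝ} {ψ : ℕ → X → W → ℝ} (n : ℕ)
    (hφ : MemLp (fun z : X × W => φ z.1 z.2) 2 (ρX.prod ρW))
    (hψ : ∀ k, MemLp (fun z : X × W => ψ k z.1 z.2) 2 (ρX.prod ρW)) {e : ℕ → ℝ}
    (he : ∀ k, ∫ z, (φ z.1 z.2 - ψ k z.1 z.2) ^ 2 ∂(ρX.prod ρW) ≤ e k)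
    (he0 : Tendsto e atTop (𝓝 0)) :
    Tendsto (fun k => spectralMoment (ψ k) ρX ρW n) atTop (𝓝 (spectralMoment φ ρX ρW n)) := by
  obtain ⟨D, hD⟩ := he0.bddAbove_range
  have hD' : ∀ k, e k ≤ |D| := fun k => (hD (Set.mem_range_self k)).trans (le_abs_self D)
  set A := ∫ z, φ z.1 z.2 ^ 2 ∂(ρX.prod ρW)
  have hA0 : 0 ≤ A := integral_nonneg fun _ => sq_nonneg _
  set B : ℝ := 2 * A + 2 * |D|
  rw [tendsto_iff_dist_tendsto_zero]
  refine squeeze_zero (fun _ => dist_nonneg) (fun k => ?_) (tendsto_momentModulus n B he0)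
  rw [dist_comm, Real.dist_eq]
  have h1 := integral_sq_le_two_mul_add hφ (hψ k)
  have := abs_nonneg D
  have := hD' k
  have := he k
  exact abs_spectralMoment_sub_le ρX ρW n hφ (hψ k) (by linarith) (by linarith) (he k)

/-- Consistency along a filter, provided that grid averages of squares are controlled along this
filter. -/
theorem IsIIDSampling.ae_tendsto_momentEstimator (h : IsIIDSampling ρX ρW μ x w)
    {φ : X → W → ℝ} (hφ : MemLp (fun z : X × W => φ z.1 z.2) 2 (ρX.prod ρW)) {n : ℕ} (hn : 1 ≤ n)
    {ι : Type*} {L : Filter ι} {u : ι → ℕ × ℕ} (hu : Tendsto u L (atTop ×ˢ atTop))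
    (hgrid : ∀ ψ : X → W → ℝ, IsSeparableSum ψ → ∀ ε > 0,
      ∫ z, (φ z.1 z.2 - ψ z.1 z.2) ^ 2 ∂(ρX.prod ρW) ≤ ε → ∀ᵐ ω ∂μ, ∀ᶠ t in L,
        gridAverage (fun y v => (φ y v - ψ y v) ^ 2) (x · ω) (w · ω) (u t).1 (u t).2 ≤ 20 * ε) :
    ∀ᵐ ω ∂μ, Tendsto (fun t => momentEstimator n
      (measurementMatrix φ (x · ω) (w · ω) (u t).1 (u t).2)) L (𝓝 (spectralMoment φ ρX ρW n)) := by
  obtain ⟨ψ, hψ, hψφ⟩ := exists_seq_isSeparableSum hφ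
  -- Taking ψ = 0 bounds the grid averages of φ² themselves; the added 1 keeps ε positive.
  have h0 := hgrid _ (isSeparableSum_const 0) (∫ z, (φ z.1 z.2 - 0) ^ 2 ∂(ρX.prod ρW) + 1)
    (by have : 0 ≤ ∫ z, (φ z.1 z.2 - 0) ^ 2 ∂(ρX.prod ρW) := integral_nonneg fun _ => sq_nonneg _
        linarith) (by linarith)
  have h1 := ae_all_iff.2 fun k => hgrid _ (hψ k) ((1 / 2) ^ k) (by positivity) (hψφ k)
  have h2 := ae_all_iff.2 fun k => h.ae_tendsto_momentEstimator_of_isSeparableSum n (hψ k)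
  have hpow : Tendsto (fun k : ℕ => (1 / 2 : ℝ) ^ k) atTop (𝓝 0) :=
    tendsto_pow_atTop_nhds_zero_of_lt_one (by norm_num) (by norm_num)
  have hm := tendsto_spectralMoment n hφ (fun k => (hψ k).memLp ρX ρW 2) hψφ hpow
  filter_upwards [h0, h1, h2] with ω e0 e1 e2
  simp only [sub_zero] at e0
  obtain ⟨δ, hδ, hδ'⟩ := exists_approx_momentEstimator hn e0 e1
    (by simpa using hpow.const_mul 20)
  exact tendsto_of_approx hδ hm (fun k => (e2 k).comp hu) hδ'

end Convergence

/-! ### One sample size fixed, and iterated limits. -/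

section IteratedLimits

variable {X W Ω : Type*} [MeasurableSpace X] [MeasurableSpace W] [MeasurableSpace Ω]
  {ρX : Measure X} {ρW : Measure W} {μ : Measure Ω} [IsProbabilityMeasure ρX]
  [IsProbabilityMeasure ρW]
  {x : ℕ → Ω → X} {w : ℕ → Ω → W}

/-- The x-value is random, so the exceptional null set of the strong law varies with it.
Independence of x_p from the whole sequence of w's and Fubini reduce to a frozen value y. -/
theorem IsIIDSampling.ae_tendsto_average_right [IsProbabilityMeasure μ] (h : IsIIDSampling ρX ρW μ x w) {f : X → W → ℝ}
    (hf : Measurable fun z : X × W => f z.1 z.2)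
    (hfi : Integrable (fun z : X × W => f z.1 z.2) (ρX.prod ρW)) (p : ℕ) :
    ∀ᵐ ω ∂μ, Tendsto (fun Q : ℕ => (∑ q ∈ Finset.range Q, f (x p ω) (w q ω)) / Q) atTop
      (𝓝 (∫ v, f (x p ω) v ∂ρW)) := by
  have mw : Measurable fun ω α => w α ω := measurable_pi_lambda _ h.measurable_feature
  have mx := h.measurable_input p
  set ν := μ.map fun ω α => w α ω with hν
  have := Measure.isProbabilityMeasure_map (μ := μ) mw.aemeasurable
  have hind : IndepFun (x p) (fun ω α => w α ω) μ :=
    h.indepFun.comp (φ := fun y : ℕ → X => y p) (ψ := id) (measurable_pi_apply p) measurable_id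
  rw [indepFun_iff_map_prod_eq_prod_map_map mx.aemeasurable mw.aemeasurable, h.law_input] at hind
  -- Subtracting the limit, which depends on z, leaves convergence to a constant, and hence a
  -- measurable set.
  let S : Set (X × (ℕ → W)) := {z | Tendsto (fun Q : ℕ =>
    (∑ q ∈ Finset.range Q, f z.1 (z.2 q)) / Q - ∫ v, f z.1 v ∂ρW) atTop (𝓝 0)}
  have hS : MeasurableSet S := by
    refine measurableSet_tendsto _ fun Q => Measurable.sub (Measurable.div_const
      (Finset.measurable_sum _ fun q _ => ?_) _)
      ((measurable_integral_left ρW hf).comp measurable_fst)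
    exact hf.comp (measurable_fst.prodMk ((measurable_pi_apply q).comp measurable_snd))
  have hae : ∀ᵐ z ∂(ρX.prod ν), z ∈ S := by
    rw [Measure.ae_prod_iff_ae_ae (p := fun z => z ∈ S) hS]
    filter_upwards [hfi.prod_right_ae] with y hy
    rw [hν, ae_map_iff mw.aemeasurable (measurable_prodMk_left hS)]
    filter_upwards [h.swap.ae_tendsto_average (hf.comp measurable_prodMk_left) hy] with ω hω
    have hω' := hω.sub_const (∫ v, f y v ∂ρW)
    simp only [Function.comp_apply, sub_self] at hω'
    exact hω'
  rw [← hind] at hae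
  filter_upwards [ae_of_ae_map (mx.prodMk mw).aemeasurable hae] with ω hω
  have hω' : Tendsto (fun Q : ℕ => (∑ q ∈ Finset.range Q, f (x p ω) (w q ω)) / Q -
    ∫ v, f (x p ω) v ∂ρW) atTop (𝓝 0) := hω
  simpa using hω'.add_const (∫ v, f (x p ω) v ∂ρW)

theorem IsIIDSampling.ae_tendsto_gridAverage_right [IsProbabilityMeasure μ] (h : IsIIDSampling ρX ρW μ x w) {f : X → W → ℝ}
    (hf : Measurable fun z : X × W => f z.1 z.2)
    (hfi : Integrable (fun z : X × W => f z.1 z.2) (ρX.prod ρW)) :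
    ∀ᵐ ω ∂μ, ∀ P : ℕ, Tendsto (fun Q : ℕ => gridAverage f (x · ω) (w · ω) P Q) atTop
      (𝓝 ((∑ p ∈ Finset.range P, ∫ v, f (x p ω) v ∂ρW) / P)) := by
  filter_upwards [ae_all_iff.2 fun p => h.ae_tendsto_average_right hf hfi p] with ω hω P
  have := (tendsto_finsetSum (Finset.range P) fun p _ => hω p).div_const (P : ℝ)
  refine this.congr fun Q => ?_
  rw [gridAverage, ← Finset.sum_div, div_div, mul_comm (Q : ℝ)]

theorem IsIIDSampling.ae_eventually_eventually_gridAverage_le [IsProbabilityMeasure μ] (h : IsIIDSampling ρX ρW μ x w)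
    {f : X → W → ℝ} (hf : Measurable fun z : X × W => f z.1 z.2)
    (hfi : Integrable (fun z : X × W => f z.1 z.2) (ρX.prod ρW)) {ε : ℝ} (hε : 0 < ε)
    (hfε : ∫ z, f z.1 z.2 ∂(ρX.prod ρW) ≤ ε) :
    ∀ᵐ ω ∂μ, ∀ᶠ P : ℕ in atTop, ∀ᶠ Q : ℕ in atTop,
      gridAverage f (x · ω) (w · ω) P Q ≤ 20 * ε := by
  have h2 := h.ae_tendsto_average (measurable_integral_left ρW hf) hfi.integral_prod_left
  rw [← integral_prod _ hfi] at h2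
  filter_upwards [h.ae_tendsto_gridAverage_right hf hfi, h2] with ω e1 e2
  filter_upwards [e2.eventually_lt_const (show _ < 20 * ε by linarith)] with P hP
  filter_upwards [(e1 P).eventually_lt_const hP] with Q hQ
  exact hQ.le

/-- The geometric rate makes the sum over k of the section integrals integrable, hence finite almost
everywhere, so its terms tend to 0. This makes approximation in L² effective on almost every single
row. -/
theorem IsIIDSampling.ae_tendsto_integral_right (h : IsIIDSampling ρX ρW μ x w)
    {f : ℕ → X → W → ℝ} (hf : ∀ k, Measurable fun z : X × W => f k z.1 z.2)
    (hf0 : ∀ k y v, 0 ≤ f k y v)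
    (hfi : ∀ k, Integrable (fun z : X × W => f k z.1 z.2) (ρX.prod ρW))
    (hfs : ∀ k, ∫ z, f k z.1 z.2 ∂(ρX.prod ρW) ≤ (1 / 2) ^ k) :
    ∀ᵐ ω ∂μ, ∀ p, Tendsto (fun k => ∫ v, f k (x p ω) v ∂ρW) atTop (𝓝 0) := by
  have hg0 : ∀ k y, 0 ≤ ∫ v, f k y v ∂ρW := fun k y => integral_nonneg fun v => hf0 k y v
  have hm : ∀ k, Measurable fun y => ENNReal.ofReal (∫ v, f k y v ∂ρW) :=
    fun k => (measurable_integral_left ρW (hf k)).ennreal_ofReal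
  have hlt : ∫⁻ y, ∑' k, ENNReal.ofReal (∫ v, f k y v ∂ρW) ∂ρX ≠ ⊤ := by
    rw [lintegral_tsum fun k => (hm k).aemeasurable]
    have hle : ∀ k, ∫⁻ y, ENNReal.ofReal (∫ v, f k y v ∂ρW) ∂ρX ≤ ENNReal.ofReal ((1 / 2) ^ k) := by
      intro k
      rw [← ofReal_integral_eq_lintegral_ofReal (hfi k).integral_prod_left (ae_of_all _ (hg0 k)),
        ← integral_prod _ (hfi k)]
      exact ENNReal.ofReal_le_ofReal (hfs k)
    refine ne_top_of_le_ne_top ?_ (ENNReal.tsum_le_tsum hle)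
    rw [← ENNReal.ofReal_tsum_of_nonneg (fun k => by positivity) summable_geometric_two]
    exact ENNReal.ofReal_ne_top
  have hae : ∀ᵐ y ∂ρX, Tendsto (fun k => ∫ v, f k y v ∂ρW) atTop (𝓝 0) := by
    filter_upwards [ae_lt_top (Measurable.tsum hm) hlt] with y hy
    have := ENNReal.tendsto_atTop_zero_of_tsum_ne_top hy.ne
    have := (ENNReal.tendsto_toReal ENNReal.zero_ne_top).comp this
    simpa [Function.comp_def, ENNReal.toReal_ofReal (hg0 _ y)] using this
  rw [ae_all_iff]
  intro p
  rw [← h.law_input p] at hae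
  exact ae_of_ae_map (h.measurable_input p).aemeasurable hae

/-- A deterministic criterion for the existence of the limit of the estimators along a filter. -/
theorem exists_tendsto_momentEstimator {X W : Type*} {n : ℕ} (hn : 1 ≤ n) {φ : X → W → ℝ}
    {ψ : ℕ → X → W → ℝ} {x : ℕ → X} {w : ℕ → W} {ι : Type*} {L : Filter ι} [L.NeBot]
    {u : ι → ℕ × ℕ} {a : ℝ} {d : ℕ → ℝ}
    (ha : Tendsto (fun t => gridAverage (fun y v => φ y v ^ 2) x w (u t).1 (u t).2) L (𝓝 a))
    (hd : ∀ k, Tendsto (fun t => gridAverage (fun y v => (φ y v - ψ k y v) ^ 2) x w (u t).1 (u t).2)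
      L (𝓝 (d k))) (hd0 : Tendsto d atTop (𝓝 0))
    (hψ : ∀ k, ∃ m, Tendsto (fun t => momentEstimator n
      (measurementMatrix (ψ k) x w (u t).1 (u t).2)) L (𝓝 m)) :
    ∃ m, Tendsto (fun t => momentEstimator n
      (measurementMatrix φ x w (u t).1 (u t).2)) L (𝓝 m) := by
  have hpow : Tendsto (fun k : ℕ => (1 / 2 : ℝ) ^ k) atTop (𝓝 0) :=
    tendsto_pow_atTop_nhds_zero_of_lt_one (by norm_num) (by norm_num)
  obtain ⟨δ, hδ, hδ'⟩ := exists_approx_momentEstimator hn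
    (ha.eventually_le_const (lt_add_one a))
    (fun k => (hd k).eventually_le_const (lt_add_of_pos_right (d k) (show (0 : ℝ) < (1 / 2) ^ k by positivity)))
    (by simpa using hd0.add hpow)
  exact exists_tendsto_of_approx hδ hψ hδ'

theorem IsIIDSampling.ae_exists_tendsto_momentEstimator_of_isSeparableSum
    (h : IsIIDSampling ρX ρW μ x w) (n : ℕ) {ψ : X → W → ℝ} (hψ : IsSeparableSum ψ) :
    ∀ᵐ ω ∂μ, (∀ P, ∃ m, Tendsto (fun Q => momentEstimator n
        (measurementMatrix ψ (x · ω) (w · ω) P Q)) atTop (𝓝 m)) ∧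
      ∀ Q, ∃ m, Tendsto (fun P => momentEstimator n
        (measurementMatrix ψ (x · ω) (w · ω) P Q)) atTop (𝓝 m) := by
  obtain ⟨ι, _, a, b, C, ha, hb, haC, hbC, rfl⟩ := hψ
  filter_upwards [h.ae_tendsto_average_mul ha haC, h.swap.ae_tendsto_average_mul hb hbC] with ω e1 e2
  simp_rw [momentEstimator_sum]
  refine ⟨fun P => ⟨_, tendsto_finsetSum _ fun r _ => tendsto_finsetSum _ fun s _ =>
    (tendsto_orderedSum_div_choose n _ _ (C * C) ?_ fun l => e2 _ _).const_mul _⟩,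
    fun Q => ⟨_, tendsto_finsetSum _ fun r _ => tendsto_finsetSum _ fun s _ =>
    (tendsto_orderedSum_div_choose n _ _ (C * C) ?_ fun l => e1 _ _).mul_const _⟩⟩
  · intro l q
    rw [abs_mul]
    exact mul_le_mul (hbC _ _) (hbC _ _) (abs_nonneg _) ((abs_nonneg _).trans (hbC (r l) (w q ω)))
  · intro l p
    rw [abs_mul]
    exact mul_le_mul (haC _ _) (haC _ _) (abs_nonneg _) ((abs_nonneg _).trans (haC (r l) (x p ω)))

theorem IsIIDSampling.ae_exists_tendsto_momentEstimator [IsProbabilityMeasure μ] (h : IsIIDSampling ρX ρW μ x w)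
    {φ : X → W → ℝ} (hφm : Measurable fun z : X × W => φ z.1 z.2)
    (hφ : MemLp (fun z : X × W => φ z.1 z.2) 2 (ρX.prod ρW)) {n : ℕ} (hn : 1 ≤ n) :
    ∀ᵐ ω ∂μ, (∀ P, ∃ m, Tendsto (fun Q => momentEstimator n
        (measurementMatrix φ (x · ω) (w · ω) P Q)) atTop (𝓝 m)) ∧
      ∀ Q, ∃ m, Tendsto (fun P => momentEstimator n
        (measurementMatrix φ (x · ω) (w · ω) P Q)) atTop (𝓝 m) := by
  obtain ⟨ψ, hψ, hψφ⟩ := exists_seq_isSeparableSum hφ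
  have hdm : ∀ k, Measurable fun z : X × W => (φ z.1 z.2 - ψ k z.1 z.2) ^ 2 :=
    fun k => (hφm.sub (hψ k).measurable).pow_const 2
  have hdi : ∀ k, Integrable (fun z : X × W => (φ z.1 z.2 - ψ k z.1 z.2) ^ 2) (ρX.prod ρW) :=
    fun k => (hφ.sub ((hψ k).memLp ρX ρW 2)).integrable_sq
  have hmap : ∀ g : X × W → ℝ, ∫ z : W × X, g z.swap ∂(ρW.prod ρX) = ∫ z, g z ∂(ρX.prod ρW) :=
    fun g => integral_prod_swap g
  filter_upwards [ae_all_iff.2 fun k => h.ae_exists_tendsto_momentEstimator_of_isSeparableSum n (hψ k),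
    h.ae_tendsto_gridAverage_right (f := fun y v => φ y v ^ 2) (hφm.pow_const 2) hφ.integrable_sq,
    h.swap.ae_tendsto_gridAverage_right (f := fun v y => φ y v ^ 2)
      ((hφm.pow_const 2).comp measurable_swap) hφ.integrable_sq.swap,
    ae_all_iff.2 fun k => h.ae_tendsto_gridAverage_right
      (f := fun y v => (φ y v - ψ k y v) ^ 2) (hdm k) (hdi k),
    ae_all_iff.2 fun k => h.swap.ae_tendsto_gridAverage_right
      (f := fun v y => (φ y v - ψ k y v) ^ 2) ((hdm k).comp measurable_swap) (hdi k).swap,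
    h.ae_tendsto_integral_right (f := fun k y v => (φ y v - ψ k y v) ^ 2) hdm
      (fun _ _ _ => sq_nonneg _) hdi hψφ,
    h.swap.ae_tendsto_integral_right (f := fun k v y => (φ y v - ψ k y v) ^ 2)
      (fun k => (hdm k).comp measurable_swap) (fun _ _ _ => sq_nonneg _) (fun k => (hdi k).swap)
      (fun k => (hmap fun z => (φ z.1 z.2 - ψ k z.1 z.2) ^ 2).le.trans (hψφ k))]
    with ω e0 e1 e1' e2 e2' e3 e3'
  refine ⟨fun P => ?_, fun Q => ?_⟩
  · refine exists_tendsto_momentEstimator hn (u := fun Q => (P, Q)) (e1 P) (fun k => e2 k P) ?_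
      fun k => (e0 k).1 P
    simpa using (tendsto_finsetSum (Finset.range P) fun p _ => e3 p).div_const (P : ℝ)
  · refine exists_tendsto_momentEstimator hn (u := fun P => (P, Q))
      ((e1' Q).congr fun P => gridAverage_swap (fun y v => φ y v ^ 2) _ _ _ _)
      (fun k => (e2' k Q).congr fun P => gridAverage_swap (fun y v => (φ y v - ψ k y v) ^ 2) _ _ _ _)
      ?_ fun k => (e0 k).2 Q
    simpa using (tendsto_finsetSum (Finset.range Q) fun q _ => e3' q).div_const (Q : ℝ)

/-- The `bind` filter expresses "for all large P, for all large Q depending on P", so an iterated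
limit becomes a limit along one filter and the general consistency statement applies. -/
theorem tendsto_of_eventually_eventually {F : ℕ → ℕ → ℝ} {g : ℕ → ℝ} {m : ℝ}
    (hg : ∀ P, Tendsto (F P) atTop (𝓝 (g P)))
    (hF : Tendsto (fun p : ℕ × ℕ => F p.1 p.2)
      ((atTop : Filter ℕ).bind fun P => (atTop : Filter ℕ).map fun Q => (P, Q)) (𝓝 m)) :
    Tendsto g atTop (𝓝 m) := by
  rw [Metric.tendsto_nhds]
  intro ε hε
  have h1 := Metric.tendsto_nhds.1 hF (ε / 2) (by positivity)
  rw [eventually_bind] at h1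
  filter_upwards [h1] with P hP
  rw [eventually_map] at hP
  have : dist (g P) m ≤ ε / 2 :=
    le_of_tendsto ((hg P).dist tendsto_const_nhds) (hP.mono fun Q hQ => hQ.le)
  linarith

theorem bind_atTop_map_le_prod :
    ((atTop : Filter ℕ).bind fun P => (atTop : Filter ℕ).map fun Q => (P, Q))
      ≤ atTop ×ˢ atTop := by
  intro s hs
  obtain ⟨t, ht, t', ht', hst⟩ := mem_prod_iff.1 hs
  rw [mem_bind']
  filter_upwards [ht] with P hP
  rw [mem_map]
  filter_upwards [ht'] with Q hQ
  exact hst ⟨hP, hQ⟩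

end IteratedLimits

/-! ### Assembly for jointly measurable kernels, then the general case. -/

section Main

variable {X W Ω : Type*} [MeasurableSpace X] [MeasurableSpace W] [MeasurableSpace Ω]
  {ρX : Measure X} {ρW : Measure W} {μ : Measure Ω} [IsProbabilityMeasure ρX]
  [IsProbabilityMeasure ρW]
  {x : ℕ → Ω → X} {w : ℕ → Ω → W}

theorem IsIIDSampling.consistency_of_measurable [IsProbabilityMeasure μ] (h : IsIIDSampling ρX ρW μ x w)
    {φ : X → W → ℝ} (hφm : Measurable fun z : X × W => φ z.1 z.2)
    (hφ : MemLp (fun z : X × W => φ z.1 z.2) 2 (ρX.prod ρW)) {n : ℕ} (hn : 1 ≤ n) :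
    (∀ P Q : ℕ → ℕ, Monotone P → Monotone Q → Tendsto P atTop atTop → Tendsto Q atTop atTop →
      ∀ᵐ ω ∂μ, Tendsto (fun t => momentEstimator n (measurementMatrix φ (x · ω) (w · ω) (P t) (Q t)))
        atTop (𝓝 (spectralMoment φ ρX ρW n))) ∧
    (∀ᵐ ω ∂μ, ∃ g : ℕ → ℝ,
      (∀ P, Tendsto (fun Q => momentEstimator n (measurementMatrix φ (x · ω) (w · ω) P Q))
        atTop (𝓝 (g P))) ∧
      Tendsto g atTop (𝓝 (spectralMoment φ ρX ρW n))) ∧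
    (∀ᵐ ω ∂μ, ∃ g : ℕ → ℝ,
      (∀ Q, Tendsto (fun P => momentEstimator n (measurementMatrix φ (x · ω) (w · ω) P Q))
        atTop (𝓝 (g Q))) ∧
      Tendsto g atTop (𝓝 (spectralMoment φ ρX ρW n))) ∧
    (MemLp (fun z : X × W => φ z.1 z.2) 4 (ρX.prod ρW) →
      ∀ᵐ ω ∂μ, Tendsto
        (fun p : ℕ × ℕ => momentEstimator n (measurementMatrix φ (x · ω) (w · ω) p.1 p.2))
        (atTop ×ˢ atTop)
        (𝓝 (spectralMoment φ ρX ρW n))) := by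
  have hdm : ∀ {ψ : X → W → ℝ}, IsSeparableSum ψ →
      Measurable fun z : X × W => (φ z.1 z.2 - ψ z.1 z.2) ^ 2 :=
    fun hψ => (hφm.sub hψ.measurable).pow_const 2
  have hdi : ∀ {ψ : X → W → ℝ}, IsSeparableSum ψ →
      Integrable (fun z : X × W => (φ z.1 z.2 - ψ z.1 z.2) ^ 2) (ρX.prod ρW) :=
    fun hψ => (hφ.sub (hψ.memLp ρX ρW 2)).integrable_sq
  have hex := h.ae_exists_tendsto_momentEstimator hφm hφ hn
  refine ⟨fun P Q hP hQ hP' hQ' => ?_, ?_, ?_, fun h4 => ?_⟩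
  · exact h.ae_tendsto_momentEstimator hφ hn (u := fun t => (P t, Q t)) (hP'.prodMk hQ')
      fun ψ hψ ε hε hle => h.ae_eventually_gridAverage_le_of_monotone
        (f := fun y v => (φ y v - ψ y v) ^ 2) (hdm hψ) (fun _ _ => sq_nonneg _) (hdi hψ) hε hle
        hP hQ hP' hQ'
  · have hlim := h.ae_tendsto_momentEstimator hφ hn
      (L := (atTop : Filter ℕ).bind fun P => (atTop : Filter ℕ).map fun Q => (P, Q)) (u := id)
      bind_atTop_map_le_prod fun ψ hψ ε hε hle => by
        filter_upwards [h.ae_eventually_eventually_gridAverage_le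
          (f := fun y v => (φ y v - ψ y v) ^ 2) (hdm hψ) (hdi hψ) hε hle] with ω hω
        rw [eventually_bind]
        exact hω
    filter_upwards [hex, hlim] with ω e1 e2
    choose g hg using e1.1
    exact ⟨g, hg, tendsto_of_eventually_eventually hg e2⟩
  · have hlim := h.ae_tendsto_momentEstimator hφ hn
      (L := (atTop : Filter ℕ).bind fun Q => (atTop : Filter ℕ).map fun P => (Q, P))
      (u := Prod.swap)
      (((tendsto_snd.prodMk tendsto_fst)).mono_left bind_atTop_map_le_prod)
      fun ψ hψ ε hε hle => by
        filter_upwards [h.swap.ae_eventually_eventually_gridAverage_le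
          (f := fun v y => (φ y v - ψ y v) ^ 2) ((hdm hψ).comp measurable_swap) (hdi hψ).swap hε
          ((integral_prod_swap fun z : X × W => (φ z.1 z.2 - ψ z.1 z.2) ^ 2).le.trans hle)] with ω hω
        rw [eventually_bind]
        simp_rw [gridAverage_swap (fun y v => (φ y v - ψ y v) ^ 2)] at hω
        exact hω
    filter_upwards [hex, hlim] with ω e1 e2
    choose g hg using e1.2
    exact ⟨g, hg, tendsto_of_eventually_eventually
      (F := fun Q P => momentEstimator n (measurementMatrix φ (x · ω) (w · ω) P Q)) hg e2⟩
  · refine h.ae_tendsto_momentEstimator hφ hn (u := id) tendsto_id fun ψ hψ ε hε hle => ?_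
    -- The fourth moment of φ - ψ is the second moment of the nonnegative function (φ - ψ)² whose
    -- grid averages are to be bounded.
    have hd4 : MemLp (fun z : X × W => φ z.1 z.2 - ψ z.1 z.2) 4 (ρX.prod ρW) :=
      h4.sub (hψ.memLp ρX ρW 4)
    refine h.ae_eventually_gridAverage_le_of_memLp_two
      (f := fun y v => (φ y v - ψ y v) ^ 2) (hdm hψ) (fun _ _ => sq_nonneg _) ?_ hε hle
    rw [memLp_two_iff_integrable_sq (hdm hψ).aestronglyMeasurable]
    have := hd4.integrable_norm_pow (by norm_num)
    refine this.congr (ae_of_all _ fun z => ?_)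
    simp only [Real.norm_eq_abs]
    rw [← pow_mul, Even.pow_abs (by decide)]

end Main

theorem mainTheorem3
    {X W Ω : Type*} [MeasurableSpace X] [MeasurableSpace W] [MeasurableSpace Ω]
    (ρX : Measure X) [IsProbabilityMeasure ρX] (ρW : Measure W) [IsProbabilityMeasure ρW]
    (φ : X → W → ℝ) (hφ : MemLp (fun z : X × W => φ z.1 z.2) 2 (ρX.prod ρW))
    (μ : Measure Ω) [IsProbabilityMeasure μ]
    (x : ℕ → Ω → X) (w : ℕ → Ω → W)
    (hx_meas : ∀ i, Measurable (x i)) (hw_meas : ∀ α, Measurable (w α))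
    (hx_law : ∀ i, μ.map (x i) = ρX) (hw_law : ∀ α, μ.map (w α) = ρW)
    (hx_indep : iIndepFun x μ) (hw_indep : iIndepFun w μ)
    (hxw_indep : IndepFun (fun ω i => x i ω) (fun ω α => w α ω) μ)
    (n : ℕ) (hn : 1 ≤ n) :
    -- the integral defining the moment converges absolutely
    Integrable (fun z : (Fin n → X) × (Fin n → W) => cyclicProduct φ z.1 z.2)
      ((Measure.pi fun _ : Fin n => ρX).prod (Measure.pi fun _ : Fin n => ρW)) ∧
    -- strong consistency along every growing sequence of sample sizes
    (∀ P Q : ℕ → ℕ, Monotone P → Monotone Q → Tendsto P atTop atTop → Tendsto Q atTop atTop →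
      ∀ᵐ ω ∂μ, Tendsto (fun t => momentEstimator n (measurementMatrix φ (x · ω) (w · ω) (P t) (Q t)))
        atTop (𝓝 (spectralMoment φ ρX ρW n))) ∧
    -- strong consistency when first `Q → ∞` and then `P → ∞`
    (∀ᵐ ω ∂μ, ∃ g : ℕ → ℝ,
      (∀ P, Tendsto (fun Q => momentEstimator n (measurementMatrix φ (x · ω) (w · ω) P Q))
        atTop (𝓝 (g P))) ∧
      Tendsto g atTop (𝓝 (spectralMoment φ ρX ρW n))) ∧
    -- strong consistency when first `P → ∞` and then `Q → ∞`
    (∀ᵐ ω ∂μ, ∃ g : ℕ → ℝ,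
      (∀ Q, Tendsto (fun P => momentEstimator n (measurementMatrix φ (x · ω) (w · ω) P Q))
        atTop (𝓝 (g Q))) ∧
      Tendsto g atTop (𝓝 (spectralMoment φ ρX ρW n))) ∧
    -- unrestricted double limit, if moreover `φ` has a finite fourth moment
    (MemLp (fun z : X × W => φ z.1 z.2) 4 (ρX.prod ρW) →
      ∀ᵐ ω ∂μ, Tendsto
        (fun p : ℕ × ℕ => momentEstimator n (measurementMatrix φ (x · ω) (w · ω) p.1 p.2))
        (atTop ×ˢ atTop)
        (𝓝 (spectralMoment φ ρX ρW n))) := by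
  have h : IsIIDSampling ρX ρW μ x w :=
    ⟨hx_meas, hw_meas, hx_law, hw_law, hx_indep, hw_indep, hxw_indep⟩
  refine ⟨integrable_cyclicProduct ρX ρW n hφ, ?_⟩
  -- Membership in L² gives only almost everywhere measurability, so a measurable version is used.
  -- The moment is unchanged because the modulus vanishes at distance 0; almost surely no matrix
  -- changes, because each (x_i, w_α) has the product law and there are countably many.
  let φ' : X → W → ℝ := fun y v => hφ.aestronglyMeasurable.mk _ (y, v)
  have hφ'm : Measurable fun z : X × W => φ' z.1 z.2 :=
    hφ.aestronglyMeasurable.stronglyMeasurable_mk.measurable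
  have hae : (fun z : X × W => φ z.1 z.2) =ᵐ[ρX.prod ρW] fun z => φ' z.1 z.2 :=
    hφ.aestronglyMeasurable.ae_eq_mk
  have hφ' : MemLp (fun z : X × W => φ' z.1 z.2) 2 (ρX.prod ρW) := hφ.ae_eq hae
  have hmoment : spectralMoment φ ρX ρW n = spectralMoment φ' ρX ρW n := by
    have hsq : ∫ z, φ' z.1 z.2 ^ 2 ∂(ρX.prod ρW) = ∫ z, φ z.1 z.2 ^ 2 ∂(ρX.prod ρW) :=
      integral_congr_ae (hae.mono fun z hz => by simp only at hz ⊢; rw [hz])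
    have hd : ∫ z, (φ z.1 z.2 - φ' z.1 z.2) ^ 2 ∂(ρX.prod ρW) = 0 :=
      integral_eq_zero_of_ae (hae.mono fun z hz => by simp only at hz ⊢; simp [hz])
    have := abs_spectralMoment_sub_le ρX ρW n hφ hφ' le_rfl hsq.le hd.le
    simp only [momentModulus, mul_zero, Real.sqrt_zero, zero_mul] at this
    exact sub_eq_zero.1 (abs_nonpos_iff.1 this)
  have hmatrix : ∀ᵐ ω ∂μ, ∀ P Q, measurementMatrix φ (x · ω) (w · ω) P Q
      = measurementMatrix φ' (x · ω) (w · ω) P Q := by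
    have : ∀ᵐ ω ∂μ, ∀ i α, φ (x i ω) (w α ω) = φ' (x i ω) (w α ω) := by
      simp_rw [ae_all_iff]
      exact fun i α => (h.measurePreserving i α).quasiMeasurePreserving.ae hae
    filter_upwards [this] with ω hω P Q
    ext i α
    exact hω i α
  obtain ⟨c1, c2, c3, c4⟩ := h.consistency_of_measurable hφ'm hφ' hn
  rw [hmoment]
  refine ⟨fun P Q hP hQ hP' hQ' => ?_, ?_, ?_, fun h4 => ?_⟩
  · filter_upwards [hmatrix, c1 P Q hP hQ hP' hQ'] with ω e1 e2
    simpa only [e1] using e2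
  · filter_upwards [hmatrix, c2] with ω e1 e2
    simpa only [e1] using e2
  · filter_upwards [hmatrix, c3] with ω e1 e2
    simpa only [e1] using e2
  · filter_upwards [hmatrix, c4 (h4.ae_eq hae)] with ω e1 e2
    simpa only [e1] using e2
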